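/- **Setting.** Let $\mathfrak g$ be a finite-dimensional semisimple Lie algebra over $\mathbb C$, $\theta$ an automorphism of $\mathfrak g$ with $\theta^2=1$, and $\mathfrak k$, $\mathfrak p$ its eigenspaces for the eigenvalues $1$ and $-1$; assume that $\mathfrak k$ is reductive in $\mathfrak g$ (that is, $(\mathfrak g,\mathfrak k)$ is a Harish-Chandra pair) and that $\mathfrak g$ has a Cartan subalgebra $\mathfrak h\subset\mathfrak k$, which we fix. Let $\mathfrak c$ be the centre of $\mathfrak k$. Each root space $\mathfrak g_\alpha$ lies in $\mathfrak k$ or in $\mathfrak p$, and the root $\alpha$ is called compact or non-compact accordingly. Let $P$ be a positive system of roots of $(\mathfrak g,\mathfrak h)$, let $P_k$ and $P_n$ be the sets of compact and of non-compact roots in $P$, and let $\mathfrak p^{\pm}=\bigoplus_{\beta\in\pm P_n}\mathfrak g_\beta$. A root $\beta$ is totally positive if $\mathfrak g_\beta$ is contained in an $\mathrm{ad}\,\mathfrak k$-stable subspace of $\mathfrak p^+$. Let $P_t$ be the set of totally positive roots, $\mathfrak p_t=\bigoplus_{\beta\in P_t}(\mathfrak g_\beta\oplus\mathfrak g_{-\beta})$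 and $\mathfrak g_t=[\mathfrak p_t,\mathfrak p_t]\oplus\mathfrak p_t$. **Theorem.** Assume $P_n=P_t$, and let $\alpha_1,\dots,\alpha_r$ be the distinct simple roots of $P_k$. Then $\mathfrak p^+$ is $\mathfrak k$-stable and has a decomposition $\mathfrak p^+=\bigoplus_{i=1}^s\mathfrak p_i^+$ into irreducible $\mathfrak k$-modules, unique up to order, and each $\mathfrak p_i^+$ has a unique lowest root $\beta_i$ (with respect to $P_k$). The roots $\alpha_1,\dots,\alpha_r,\beta_1,\dots,\beta_s$ are distinct and form the set of simple roots of $P$. Moreover: (a) $r+s=\dim\mathfrak h$. (b) $\mathfrak c\subset\mathfrak h$, $s=\dim\mathfrak c$, and the restrictions of $\beta_1,\dots,\beta_s$ to $\mathfrak c$ are linearly independent. (c) For every $\beta\in P_n$ there are a unique index $i$ and unique integers $m_1,\dots,m_r\ge 0$ with $\beta=\beta_i+m_1\alpha_1+\dots+m_r\alpha_r$. Furthermore $[\mathfrak p^+,\mathfrak p^+]=0$. (d) Suppose in addition that $\mathfrak g=\mathfrak g_t$. Let $\mathfrak p_i^-$ be the sum of the $\mathfrak g_{-\gamma}$ over the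 roots $\gamma$ with $\mathfrak g_\gamma\subset\mathfrak p_i^+$, and let $\mathfrak p_i=\mathfrak p_i^+\oplus\mathfrak p_i^-$, $\mathfrak k_i=[\mathfrak p_i,\mathfrak p_i]$, $\mathfrak g_i=\mathfrak k_i\oplus\mathfrak p_i$. Then $\mathfrak g$ is the direct sum of $\mathfrak g_1,\dots,\mathfrak g_s$, and each $\mathfrak g_i$ is a $\theta$-stable ideal of $\mathfrak g$ with $\mathfrak g_i\cap\mathfrak k=\mathfrak k_i$ and $\mathfrak g_i\cap\mathfrak p=\mathfrak p_i$, is a simple Lie algebra, and the centre of $\mathfrak k_i$ has dimension $1$. Moreover $(\mathfrak g_i,\mathfrak k_i)$ is a Harish-Chandra pair, $\mathfrak h\cap\mathfrak g_i\subset\mathfrak k_i$ is a Cartan subalgebra of $\mathfrak g_i$, the restrictions to $\mathfrak h\cap\mathfrak g_i$ of the $\gamma\in P$ with $\mathfrak g_\gamma\subset\mathfrak g_i$ form a positive system, and all positive non-compact roots of $\mathfrak g_i$ are totally positive with respect to it. (e) The $\mathfrak p_i^+$ are pairwise distinct and are exactly the irreducible $\mathfrak k$-submodules of $\mathfrak p^+$,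 so $s$ is the number of irreducible components of $\mathfrak p^+$. If $\mathfrak g=\mathfrak g_t$, then $\mathfrak g$ is simple if and only if $\mathfrak p^+$ is an irreducible $\mathfrak k$-module. -/

import Mathlib

/-!
Symmetric pairs `(𝔤, 𝔨)` of complex Lie algebras of equal rank, compact and non-compact roots,
totally positive roots.

Throughout, `θ` is an automorphism of `𝔤`, `𝔥` is a subalgebra of `𝔤` (in the applications a Cartan
subalgebra of `𝔤` contained in the fixed algebra `𝔨` of `θ`), and roots are linear forms on `𝔥`.
-/

namespace HarishChandra

noncomputable section

section Defs

variable {𝔤 : Type*} [LieRing 𝔤] [LieAlgebra ℂ 𝔤]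

/-- `𝔨`: the subalgebra of fixed points of `θ`. -/
def kk (θ : 𝔤 ≃ₗ⁅ℂ⁆ 𝔤) : LieSubalgebra ℂ 𝔤 where
  carrier := {x | θ x = x}
  add_mem' {x y} hx hy := by
    change θ (x + y) = x + y
    change θ x = x at hx
    change θ y = y at hy
    rw [map_add, hx, hy]
  zero_mem' := map_zero θ
  smul_mem' c x hx := by
    change θ (c • x) = c • x
    change θ x = x at hx
    rw [map_smul, hx]
  lie_mem' {x y} hx hy := by
    change θ ⁅x, y⁆ = ⁅x, y⁆
    change θ x = x at hx
    change θ y = y at hy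
    rw [LieEquiv.map_lie, hx, hy]

/-- `𝔭`: the `(-1)`-eigenspace of `θ`. -/
def pp (θ : 𝔤 ≃ₗ⁅ℂ⁆ 𝔤) : Submodule ℂ 𝔤 where
  carrier := {x | θ x = -x}
  add_mem' {x y} hx hy := by
    change θ (x + y) = -(x + y)
    change θ x = -x at hx
    change θ y = -y at hy
    rw [map_add, hx, hy, neg_add]
  zero_mem' := by
    change θ 0 = -0
    rw [map_zero, neg_zero]
  smul_mem' c x hx := by
    change θ (c • x) = -(c • x)
    change θ x = -x at hx
    rw [map_smul, hx, smul_neg]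

/-- `(𝔤, 𝔨)` is a Harish-Chandra pair: `𝔤` is semisimple, `𝔨` is the fixed algebra of the involutive
automorphism `θ`, and `𝔨` is reductive in `𝔤`, that is, `𝔤` is a completely reducible `𝔨`-module. -/
structure IsHCPair (θ : 𝔤 ≃ₗ⁅ℂ⁆ 𝔤) : Prop where
  semisimple : LieAlgebra.IsSemisimple ℂ 𝔤
  involutive : ∀ x, θ (θ x) = x
  reductive : ComplementedLattice (LieSubmodule ℂ (kk θ) 𝔤)

/-- The subspace `𝔤_α` of all `x` with `[H, x] = α(H) x` for all `H ∈ 𝔥`. -/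
def rootSpace (𝔥 : LieSubalgebra ℂ 𝔤) (α : Module.Dual ℂ 𝔥) : Submodule ℂ 𝔤 :=
  (LieModule.weightSpace 𝔤 (α : 𝔥 → ℂ)).toSubmodule

/-- The roots of `(𝔤, 𝔥)`. -/
def roots (𝔥 : LieSubalgebra ℂ 𝔤) : Set (Module.Dual ℂ 𝔥) :=
  {α | α ≠ 0 ∧ rootSpace 𝔥 α ≠ ⊥}

/-- `P` is a positive system of roots of `(𝔤, 𝔥)`: the set of roots is the disjoint union of `P` and
`-P`, and a sum of two elements of `P` which is a root lies in `P`. -/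
structure IsPositiveSystem (𝔥 : LieSubalgebra ℂ 𝔤) (P : Set (Module.Dual ℂ 𝔥)) : Prop where
  subset_roots : P ⊆ roots 𝔥
  mem_or_neg_mem : ∀ α ∈ roots 𝔥, α ∈ P ∨ -α ∈ P
  neg_notMem : ∀ α ∈ P, -α ∉ P
  add_mem : ∀ α ∈ P, ∀ β ∈ P, α + β ∈ roots 𝔥 → α + β ∈ P

/-- The simple elements of a positive system `S`: those which are not a sum of two elements of `S`. -/
def simpleRoots {V : Type*} [AddCommGroup V] (S : Set V) : Set V :=
  {α | α ∈ S ∧ ∀ β ∈ S, ∀ γ ∈ S, α ≠ β + γ}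

/-- `P_k`: the compact roots in `P`, those with `𝔤_α ⊆ 𝔨`. -/
def compactRoots (θ : 𝔤 ≃ₗ⁅ℂ⁆ 𝔤) {𝔥 : LieSubalgebra ℂ 𝔤} (P : Set (Module.Dual ℂ 𝔥)) :
    Set (Module.Dual ℂ 𝔥) :=
  {α | α ∈ P ∧ rootSpace 𝔥 α ≤ (kk θ).toSubmodule}

/-- `P_n`: the non-compact roots in `P`, those with `𝔤_α ⊆ 𝔭`. -/
def noncompactRoots (θ : 𝔤 ≃ₗ⁅ℂ⁆ 𝔤) {𝔥 : LieSubalgebra ℂ 𝔤} (P : Set (Module.Dual ℂ 𝔥)) :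
    Set (Module.Dual ℂ 𝔥) :=
  {α | α ∈ P ∧ rootSpace 𝔥 α ≤ pp θ}

/-- The sum of the root spaces `𝔤_γ`, `γ ∈ R`. -/
def rootSum {𝔥 : LieSubalgebra ℂ 𝔤} (R : Set (Module.Dual ℂ 𝔥)) : Submodule ℂ 𝔤 :=
  ⨆ γ ∈ R, rootSpace 𝔥 γ

/-- `𝔭⁺`: the sum of the positive non-compact root spaces. -/
def pPlus (θ : 𝔤 ≃ₗ⁅ℂ⁆ 𝔤) {𝔥 : LieSubalgebra ℂ 𝔤} (P : Set (Module.Dual ℂ 𝔥)) :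
    Submodule ℂ 𝔤 :=
  rootSum (noncompactRoots θ P)

/-- `P_t`: the totally positive roots, i.e. the roots `β` such that `𝔤_β` is contained in a subspace
of `𝔭⁺` which is stable under `𝔨`. -/
def totallyPositiveRoots (θ : 𝔤 ≃ₗ⁅ℂ⁆ 𝔤) {𝔥 : LieSubalgebra ℂ 𝔤} (P : Set (Module.Dual ℂ 𝔥)) :
    Set (Module.Dual ℂ 𝔥) :=
  {β | β ∈ roots 𝔥 ∧ ∃ m : LieSubmodule ℂ (kk θ) 𝔤,
    m.toSubmodule ≤ pPlus θ P ∧ rootSpace 𝔥 β ≤ m.toSubmodule}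

/-- The linear span `[V, W]` of all brackets `[x, y]`, `x ∈ V`, `y ∈ W`. -/
def bracket (V W : Submodule ℂ 𝔤) : Submodule ℂ 𝔤 :=
  Submodule.span ℂ {z | ∃ x ∈ V, ∃ y ∈ W, ⁅x, y⁆ = z}

/-- `𝔭_t = 𝔭_t⁺ ⊕ 𝔭_t⁻`: the sum of the root spaces of the totally positive roots and of their
negatives. -/
def pTotal (θ : 𝔤 ≃ₗ⁅ℂ⁆ 𝔤) {𝔥 : LieSubalgebra ℂ 𝔤} (P : Set (Module.Dual ℂ 𝔥)) :
    Submodule ℂ 𝔤 :=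
  rootSum (totallyPositiveRoots θ P) ⊔ rootSum {γ | -γ ∈ totallyPositiveRoots θ P}

/-- `𝔤_t = [𝔭_t, 𝔭_t] ⊕ 𝔭_t`. -/
def gTotal (θ : 𝔤 ≃ₗ⁅ℂ⁆ 𝔤) {𝔥 : LieSubalgebra ℂ 𝔤} (P : Set (Module.Dual ℂ 𝔥)) :
    Submodule ℂ 𝔤 :=
  bracket (pTotal θ P) (pTotal θ P) ⊔ pTotal θ P

/-- The subspace `W` of `𝔤` is an irreducible `𝔨`-submodule. -/
def IsIrreducibleSubspace (θ : 𝔤 ≃ₗ⁅ℂ⁆ 𝔤) (W : Submodule ℂ 𝔤) : Prop :=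
  ∃ m : LieSubmodule ℂ (kk θ) 𝔤, m.toSubmodule = W ∧ LieModule.IsIrreducible ℂ (kk θ) m

/-- `W_1, …, W_s` is a decomposition of `𝔭⁺` as a direct sum of irreducible `𝔨`-modules. -/
structure IsDecomposition (θ : 𝔤 ≃ₗ⁅ℂ⁆ 𝔤) {𝔥 : LieSubalgebra ℂ 𝔤} (P : Set (Module.Dual ℂ 𝔥))
    {s : ℕ} (W : Fin s → Submodule ℂ 𝔤) : Prop where
  irreducible : ∀ i, IsIrreducibleSubspace θ (W i)
  independent : iSupIndep W
  sum_eq : ⨆ i, W i = pPlus θ P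

/-- The root `β` is a lowest root of `W`, with respect to the positive compact roots: the root space
`𝔤_β` is contained in `W` and is annihilated by `𝔤_{-α}` for all `α ∈ P_k`. -/
structure IsLowestRoot (θ : 𝔤 ≃ₗ⁅ℂ⁆ 𝔤) {𝔥 : LieSubalgebra ℂ 𝔤} (P : Set (Module.Dual ℂ 𝔥))
    (W : Submodule ℂ 𝔤) (β : Module.Dual ℂ 𝔥) : Prop where
  mem_roots : β ∈ roots 𝔥
  rootSpace_le : rootSpace 𝔥 β ≤ W
  lie_eq_zero : ∀ α ∈ compactRoots θ P, ∀ x ∈ rootSpace 𝔥 (-α), ∀ y ∈ rootSpace 𝔥 β, ⁅x, y⁆ = 0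

/-- `W ⊕ W⁻`, where `W⁻` is the sum of the root spaces `𝔤_{-γ}` with `γ` a root such that
`𝔤_γ ⊆ W`. -/
def withNegative (𝔥 : LieSubalgebra ℂ 𝔤) (W : Submodule ℂ 𝔤) : Submodule ℂ 𝔤 :=
  W ⊔ rootSum {γ : Module.Dual ℂ 𝔥 | -γ ∈ roots 𝔥 ∧ rootSpace 𝔥 (-γ) ≤ W}

/-- `𝔠`: the centre of `𝔨`, as a subspace of `𝔤`. -/
def centre (θ : 𝔤 ≃ₗ⁅ℂ⁆ 𝔤) : Submodule ℂ 𝔤 :=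
  (LieAlgebra.center ℂ (kk θ)).toSubmodule.map (kk θ).toSubmodule.subtype

/-- The restriction to `𝔠 ∩ 𝔥` of a linear form on `𝔥`. -/
def restrictToCentre (θ : 𝔤 ≃ₗ⁅ℂ⁆ 𝔤) {𝔥 : LieSubalgebra ℂ 𝔤} (β : Module.Dual ℂ 𝔥) :
    Module.Dual ℂ ((centre θ).comap 𝔥.toSubmodule.subtype) :=
  β.comp ((centre θ).comap 𝔥.toSubmodule.subtype).subtype

/-- `𝔥 ∩ I`, as a subalgebra of the ideal `I`. -/
def idealCartan (𝔥 : LieSubalgebra ℂ 𝔤) (I : LieIdeal ℂ 𝔤) : LieSubalgebra ℂ I :=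
  𝔥.comap I.incl

/-- The restriction to `𝔥 ∩ I` of a linear form on `𝔥`. -/
def restrictToIdeal {𝔥 : LieSubalgebra ℂ 𝔤} (I : LieIdeal ℂ 𝔤) (γ : Module.Dual ℂ 𝔥) :
    Module.Dual ℂ (idealCartan 𝔥 I) where
  toFun H := γ ⟨((H : I) : 𝔤), H.2⟩
  map_add' H H' := by
    rw [← map_add]
    rfl
  map_smul' c H := by
    rw [RingHom.id_apply, ← map_smul]
    rfl

/-- The positive system induced by `P` on the ideal `I`: the restrictions to `𝔥 ∩ I` of those `γ ∈ P`
for which `𝔤_γ ⊆ I`. -/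
def idealPositive {𝔥 : LieSubalgebra ℂ 𝔤} (P : Set (Module.Dual ℂ 𝔥)) (I : LieIdeal ℂ 𝔤) :
    Set (Module.Dual ℂ (idealCartan 𝔥 I)) :=
  restrictToIdeal I '' {γ | γ ∈ P ∧ rootSpace 𝔥 γ ≤ I.toSubmodule}

end Defs

end

end HarishChandra

/-! Total positivity of all of P_n makes 𝔭⁺ stable under 𝔨 (`lie_mem_pPlus`), so adding a compact
root of either sign to a root of P_n gives, if a root at all, a root of P_n
(`add_mem_noncompactRoots`). Two roots of P_n therefore never add up to a root (`add_notMem_roots`):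
the sum would be compact, and subtracting it from one summand would put the negative of the other in
P_n. So compact positive roots behave as degree 0 and non-compact ones as degree 1: the simple roots
of P_k are the compact simple roots of P, and every root of P_n is one non-compact simple root β
plus a nonnegative combination of compact simple roots (`mem_closure_simpleRoots`).

Simple roots are linearly independent, so β is determined by the class modulo the span of the
compact roots; these classes (`pieceRoots`) cut 𝔭⁺ into 𝔨-stable pieces. Subtracting compact roots
shows that a nonzero 𝔨-submodule of 𝔭⁺ contains the root space of a non-compact simple root
(`exists_rootSpace_le`). With complete reducibility each piece is irreducible, there are no other
irreducible submodules, and β is the lowest root of its piece. The dimension counts follow because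
the simple roots form a basis of the dual of 𝔥 and the centre of 𝔨 is the common kernel of the
compact ones (`centre_comap_eq`).

A difference of roots from distinct pieces, were it a root, would be compact, although the two
classes differ; so different 𝔭_i commute (`lie_withNegative_eq_zero`) and, when 𝔤 = 𝔤_t, each 𝔨_i ⊕
𝔭_i is an ideal. A subideal containing a root space of 𝔭_i is everything; one containing none lies
in 𝔨, commutes with 𝔤_t and vanishes (`isAtom_pieceIdeal`). The hypotheses pass to 𝔤_i
(`IsTotallyPositive.restrict`), where only one non-compact simple root remains, so the general
formula for the dimension of the centre gives 1. -/

namespace HarishChandra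

/-! ### Root spaces, their brackets, and 𝔥-stable subspaces -/

section RootSpaces

variable {𝔤 : Type*} [LieRing 𝔤] [LieAlgebra ℂ 𝔤] {𝔥 : LieSubalgebra ℂ 𝔤}

lemma mem_rootSpace {γ : Module.Dual ℂ 𝔥} {x : 𝔤} :
    x ∈ rootSpace 𝔥 γ ↔ ∀ H : 𝔥, ⁅(H : 𝔤), x⁆ = γ H • x :=
  LieModule.mem_weightSpace _ x

lemma lie_mem_rootSpace_add {γ δ : Module.Dual ℂ 𝔥} {x y : 𝔤} (hx : x ∈ rootSpace 𝔥 γ)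
    (hy : y ∈ rootSpace 𝔥 δ) : ⁅x, y⁆ ∈ rootSpace 𝔥 (γ + δ) := by
  rw [mem_rootSpace] at *
  intro H
  rw [leibniz_lie, hx, hy, smul_lie, lie_smul, ← add_smul, LinearMap.add_apply]

lemma rootSpace_le_rootSum {Q : Set (Module.Dual ℂ 𝔥)} {γ : Module.Dual ℂ 𝔥} (h : γ ∈ Q) :
    rootSpace 𝔥 γ ≤ rootSum Q :=
  le_iSup₂_of_le γ h le_rfl

lemma rootSum_le {Q : Set (Module.Dual ℂ 𝔥)} {N : Submodule ℂ 𝔤}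
    (h : ∀ γ ∈ Q, rootSpace 𝔥 γ ≤ N) : rootSum Q ≤ N :=
  iSup₂_le h

lemma rootSum_mono {Q Q' : Set (Module.Dual ℂ 𝔥)} (h : Q ⊆ Q') :
    rootSum Q ≤ rootSum Q' :=
  rootSum_le fun _ hγ => rootSpace_le_rootSum (h hγ)

lemma exists_ne_zero_of_mem_roots {γ : Module.Dual ℂ 𝔥} (h : γ ∈ roots 𝔥) :
    ∃ x ∈ rootSpace 𝔥 γ, x ≠ 0 :=
  (Submodule.ne_bot_iff _).mp h.2

/-- Two root spaces commute if the sum of their roots is neither zero nor a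
root. -/
lemma lie_eq_zero_of_add_notMem {α β : Module.Dual ℂ 𝔥} (h0 : α + β ≠ 0) (h : α + β ∉ roots 𝔥)
    {x y : 𝔤} (hx : x ∈ rootSpace 𝔥 α) (hy : y ∈ rootSpace 𝔥 β) : ⁅x, y⁆ = 0 := by
  have h1 : rootSpace 𝔥 (α + β) = ⊥ := by
    by_contra h2
    exact h ⟨h0, h2⟩
  simpa [h1] using lie_mem_rootSpace_add hx hy

variable [FiniteDimensional ℂ 𝔤] [LieAlgebra.IsKilling ℂ 𝔤] [𝔥.IsCartanSubalgebra]

lemma rootSpace_eq_genWeightSpace (γ : Module.Dual ℂ 𝔥) :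
    rootSpace 𝔥 γ = (LieAlgebra.rootSpace 𝔥 (γ : 𝔥 → ℂ)).toSubmodule := by
  refine le_antisymm (fun x hx => LieModule.weightSpace_le_genWeightSpace 𝔤 _ hx) fun x hx => ?_
  rw [mem_rootSpace]
  exact fun H => LieAlgebra.IsKilling.lie_eq_smul_of_mem_rootSpace hx H

lemma rootSpace_zero : rootSpace 𝔥 0 = 𝔥.toSubmodule := by
  rw [rootSpace_eq_genWeightSpace]
  have := LieAlgebra.rootSpace_zero_eq ℂ 𝔤 𝔥
  change (LieAlgebra.rootSpace 𝔥 0).toSubmodule = _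
  rw [this]
  rfl

lemma lie_cartan_eq_zero {x y : 𝔤} (hx : x ∈ 𝔥) (hy : y ∈ 𝔥) : ⁅x, y⁆ = 0 := by
  have h : y ∈ rootSpace 𝔥 0 := by rwa [rootSpace_zero]
  simpa using mem_rootSpace.mp h ⟨x, hx⟩

lemma mem_cartan_of_lie_eq_zero {x : 𝔤} (h : ∀ y ∈ 𝔥, ⁅y, x⁆ = 0) : x ∈ 𝔥 := by
  have : x ∈ rootSpace 𝔥 0 := mem_rootSpace.mpr fun H => by simpa using h H H.2
  rwa [rootSpace_zero] at this

/-- The weight attached to a root. -/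
lemma exists_weight_of_rootSpace_ne_bot {γ : Module.Dual ℂ 𝔥} (h : rootSpace 𝔥 γ ≠ ⊥) :
    ∃ w : LieModule.Weight ℂ 𝔥 𝔤, LieModule.Weight.toLinear ℂ 𝔥 𝔤 w = γ := by
  refine ⟨⟨γ, fun h' => h ?_⟩, rfl⟩
  rw [rootSpace_eq_genWeightSpace]
  change LieAlgebra.rootSpace 𝔥 (γ : 𝔥 → ℂ) = ⊥ at h'
  rw [h']
  rfl

lemma rootSpace_weight_ne_bot (w : LieModule.Weight ℂ 𝔥 𝔤) :
    rootSpace 𝔥 (LieModule.Weight.toLinear ℂ 𝔥 𝔤 w) ≠ ⊥ := by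
  rw [rootSpace_eq_genWeightSpace]
  intro h
  exact w.genWeightSpace_ne_bot _ (LieSubmodule.toSubmodule_injective h)

/-- The index of a root in the root system of `(𝔤, 𝔥)`. -/
lemma exists_root_eq {γ : Module.Dual ℂ 𝔥} (h : γ ∈ roots 𝔥) :
    ∃ i : 𝔥.root, (LieAlgebra.IsKilling.rootSystem 𝔥).root i = γ := by
  obtain ⟨w, rfl⟩ := exists_weight_of_rootSpace_ne_bot h.2
  refine ⟨⟨w, ?_⟩, rfl⟩
  simp only [Finset.mem_filter, Finset.mem_univ, true_and]
  intro h0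
  refine h.1 (LinearMap.ext fun x => ?_)
  exact congrFun h0 x

lemma root_mem_roots (i : 𝔥.root) : (LieAlgebra.IsKilling.rootSystem 𝔥).root i ∈ roots 𝔥 := by
  refine ⟨(LieAlgebra.IsKilling.rootSystem 𝔥).ne_zero i, ?_⟩
  rw [LieAlgebra.IsKilling.rootSystem_root_apply]
  exact rootSpace_weight_ne_bot i.1

variable (𝔥) in
lemma range_root_eq : Set.range (LieAlgebra.IsKilling.rootSystem 𝔥).root = roots 𝔥 := by
  ext γ
  exact ⟨by rintro ⟨i, rfl⟩; exact root_mem_roots i, exists_root_eq⟩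

variable (𝔥) in
lemma finite_roots : (roots 𝔥).Finite := by
  rw [← range_root_eq]
  exact Set.finite_range _

lemma neg_mem_roots {γ : Module.Dual ℂ 𝔥} (h : γ ∈ roots 𝔥) : -γ ∈ roots 𝔥 := by
  rw [← range_root_eq] at *
  exact (LieAlgebra.IsKilling.rootSystem 𝔥).neg_mem_range_root_iff.mpr h

lemma finrank_rootSpace {γ : Module.Dual ℂ 𝔥} (h : γ ∈ roots 𝔥) :
    Module.finrank ℂ (rootSpace 𝔥 γ) = 1 := by
  obtain ⟨⟨w, hw⟩, rfl⟩ := exists_root_eq h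
  have := LieAlgebra.IsKilling.finrank_rootSpace_eq_one w (by simpa using hw)
  rw [LieAlgebra.IsKilling.rootSystem_root_apply, rootSpace_eq_genWeightSpace]
  exact this

/-- Root spaces are one-dimensional, hence atoms. This turns questions about 𝔥-stable subspaces into
questions about sets of roots. -/
lemma inf_eq_bot_or_rootSpace_le {γ : Module.Dual ℂ 𝔥} (h : γ ∈ roots 𝔥) (N : Submodule ℂ 𝔤) :
    N ⊓ rootSpace 𝔥 γ = ⊥ ∨ rootSpace 𝔥 γ ≤ N := by
  have ha : IsAtom (rootSpace 𝔥 γ) := Submodule.isAtom_iff_finrank_eq_one.mpr (finrank_rootSpace h)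
  rcases ha.le_iff.mp (inf_le_right : N ⊓ rootSpace 𝔥 γ ≤ _) with h1 | h1
  · exact Or.inl h1
  · exact Or.inr (inf_eq_right.mp h1)

lemma rootSpace_le_of_mem {γ : Module.Dual ℂ 𝔥} (h : γ ∈ roots 𝔥) {N : Submodule ℂ 𝔤} {x : 𝔤}
    (hx : x ∈ rootSpace 𝔥 γ) (h0 : x ≠ 0) (hN : x ∈ N) : rootSpace 𝔥 γ ≤ N := by
  refine (inf_eq_bot_or_rootSpace_le h N).resolve_left fun hb => h0 ?_
  have : x ∈ N ⊓ rootSpace 𝔥 γ := ⟨hN, hx⟩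
  rwa [hb, Submodule.mem_bot] at this

variable (𝔥) in
lemma iSupIndep_rootSpace : iSupIndep fun γ : Module.Dual ℂ 𝔥 => rootSpace 𝔥 γ := by
  have := LieSubmodule.iSupIndep_toSubmodule.mpr (LieModule.iSupIndep_genWeightSpace ℂ 𝔥 𝔤)
  have h2 := this.comp (f := fun γ : Module.Dual ℂ 𝔥 => (γ : 𝔥 → ℂ)) DFunLike.coe_injective
  convert h2 using 2 with γ
  exact rootSpace_eq_genWeightSpace γ

/-- A subspace stable under `𝔥` is the sum of its intersections with the root spaces. -/
lemma eq_iSup_inf_rootSpace (N : Submodule ℂ 𝔤) (hN : ∀ H ∈ 𝔥, ∀ x ∈ N, ⁅H, x⁆ ∈ N) :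
    N = ⨆ γ : Module.Dual ℂ 𝔥, N ⊓ rootSpace 𝔥 γ := by
  refine le_antisymm ?_ (iSup_le fun _ => inf_le_left)
  let N' : LieSubmodule ℂ 𝔥 𝔤 := { N with lie_mem := fun {H x} hx => hN H H.2 x hx }
  have h := LieModule.eq_iSup_inf_genWeightSpace (K := ℂ) (L := 𝔥) (M := 𝔤) N'
  have h2 := congrArg LieSubmodule.toSubmodule h
  rw [LieSubmodule.iSup_toSubmodule] at h2
  change N = _ at h2
  conv_lhs => rw [h2]
  refine iSup_le fun w => le_iSup_of_le (LieModule.Weight.toLinear ℂ 𝔥 𝔤 w) ?_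
  rw [rootSpace_eq_genWeightSpace]
  exact le_rfl

/-- Independence of the root spaces recovers the index set from the sum. -/
lemma mem_of_rootSpace_inf_rootSum_ne_bot {Q : Set (Module.Dual ℂ 𝔥)} {γ : Module.Dual ℂ 𝔥}
    (h : rootSum Q ⊓ rootSpace 𝔥 γ ≠ ⊥) : γ ∈ Q := by
  by_contra hγ
  exact h ((iSupIndep_rootSpace 𝔥).disjoint_biSup hγ).symm.eq_bot

lemma mem_of_rootSpace_le_rootSum {Q : Set (Module.Dual ℂ 𝔥)} {γ : Module.Dual ℂ 𝔥}
    (hγ : γ ∈ roots 𝔥) (h : rootSpace 𝔥 γ ≤ rootSum Q) : γ ∈ Q :=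
  mem_of_rootSpace_inf_rootSum_ne_bot (by rw [inf_eq_right.mpr h]; exact hγ.2)

open LieModule LieAlgebra.IsKilling in
/-- If `α`, `β` and `α + β` are roots, then `[𝔤_α, 𝔤_β] ≠ 0`. -/
lemma exists_lie_ne_zero {α β : Module.Dual ℂ 𝔥} (hα : α ∈ roots 𝔥) (hβ : β ∈ roots 𝔥)
    (hαβ : α + β ∈ roots 𝔥) :
    ∃ x ∈ rootSpace 𝔥 α, ∃ y ∈ rootSpace 𝔥 β, ⁅x, y⁆ ≠ 0 := by
  -- The `sl₂`-triple is taken for a = -α, so its lowering vector f lies in 𝔤_α. In the a-string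
  -- through b = α + β the root β = b + a is one step above b.
  obtain ⟨⟨a, ha⟩, ha'⟩ := exists_root_eq (neg_mem_roots hα)
  obtain ⟨⟨b, hb⟩, hb'⟩ := exists_root_eq hαβ
  rw [LieAlgebra.IsKilling.rootSystem_root_apply] at ha' hb'
  have ha0 : a.IsNonZero := by simpa using ha
  have ha1 : (a : 𝔥 → ℂ) = ⇑(-α) := by rw [← ha']; rfl
  have hb1 : (b : 𝔥 → ℂ) = ⇑(α + β) := by rw [← hb']; rfl
  have hab : LieAlgebra.rootSpace 𝔥 ((1 : ℤ) • (a : 𝔥 → ℂ) + b) ≠ ⊥ := by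
    intro h
    refine hβ.2 ?_
    rw [rootSpace_eq_genWeightSpace]
    have e : (1 : ℤ) • (a : 𝔥 → ℂ) + b = ⇑β := by
      rw [ha1, hb1]; ext H; simp
    rw [e] at h
    rw [h]; rfl
  have hr : 1 ≤ chainTopCoeff a b := by
    have := ((rootSpace_zsmul_add_ne_bot_iff a b ha0 1).mp hab).1
    exact_mod_cast this
  obtain ⟨v, hv, v0⟩ := (chainTop a b).exists_ne_zero
  obtain ⟨h, e, f, isSl2, he, hf⟩ := exists_isSl2Triple_of_weight_isNonZero ha0
  obtain rfl := isSl2.h_eq_coroot ha0 he hf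
  have prim : isSl2.HasPrimitiveVectorWith v (chainLength a b : ℂ) :=
    have := LieAlgebra.lie_mem_genWeightSpace_of_mem_genWeightSpace he hv
    ⟨v0, (chainLength_smul _ _ hv).symm, by rwa [genWeightSpace_add_chainTop _ _ ha0] at this⟩
  -- From the top vector v of the string, n lowerings reach weight β and one more reaches α + β; the
  -- string is long enough for the last step to be nonzero.
  obtain ⟨n, hn⟩ : ∃ n, chainTopCoeff a b = n + 1 := ⟨chainTopCoeff a b - 1, by omega⟩
  refine ⟨f, ?_, (toEnd ℂ 𝔤 𝔤 f ^ n) v, ?_, ?_⟩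
  · rw [rootSpace_eq_genWeightSpace]
    have : ⇑α = -(a : 𝔥 → ℂ) := by rw [ha1]; ext; simp
    rw [this]; exact hf
  · rw [rootSpace_eq_genWeightSpace]
    have e : ⇑β = n • (-(a : 𝔥 → ℂ)) + chainTop a b := by
      rw [coe_chainTop, hn, ha1, hb1]; ext H; simp; ring
    rw [e]
    exact LieAlgebra.toEnd_pow_apply_mem hf hv n
  · have := prim.pow_toEnd_f_ne_zero_of_eq_nat rfl
      (hn ▸ chainTopCoeff_le_chainLength a b : n + 1 ≤ chainLength a b)
    rw [pow_succ'] at this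
    exact this

/-- A subspace containing all brackets of `𝔤_α` and `𝔤_β` contains `𝔤_{α + β}`. -/
lemma rootSpace_add_le {α β : Module.Dual ℂ 𝔥} (hα : α ∈ roots 𝔥) (hβ : β ∈ roots 𝔥)
    (hαβ : α + β ∈ roots 𝔥) {N : Submodule ℂ 𝔤}
    (h : ∀ x ∈ rootSpace 𝔥 α, ∀ y ∈ rootSpace 𝔥 β, ⁅x, y⁆ ∈ N) : rootSpace 𝔥 (α + β) ≤ N := by
  obtain ⟨x, hx, y, hy, h0⟩ := exists_lie_ne_zero hα hβ hαβ
  exact rootSpace_le_of_mem hαβ (lie_mem_rootSpace_add hx hy) h0 (h x hx y hy)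

/-- For a root `α`, `[𝔤_α, 𝔤_{-α}] ≠ 0`. -/
lemma exists_lie_neg_ne_zero {α : Module.Dual ℂ 𝔥} (hα : α ∈ roots 𝔥) :
    ∃ x ∈ rootSpace 𝔥 α, ∃ y ∈ rootSpace 𝔥 (-α), ⁅x, y⁆ ≠ 0 := by
  obtain ⟨⟨a, ha⟩, rfl⟩ := exists_root_eq hα
  have ha0 : a.IsNonZero := by simpa using ha
  obtain ⟨h, e, f, isSl2, he, hf⟩ :=
    LieAlgebra.IsKilling.exists_isSl2Triple_of_weight_isNonZero ha0
  refine ⟨e, ?_, f, ?_, isSl2.lie_e_f ▸ isSl2.h_ne_zero⟩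
  · rw [rootSpace_eq_genWeightSpace]
    exact he
  · rw [rootSpace_eq_genWeightSpace]
    exact hf

/-- An ideal containing `𝔤_α` contains `𝔤_{-α}`. -/
lemma rootSpace_neg_le_of_le {α : Module.Dual ℂ 𝔥} (hα : α ∈ roots 𝔥) {J : LieIdeal ℂ 𝔤}
    (hJ : rootSpace 𝔥 α ≤ J.toSubmodule) : rootSpace 𝔥 (-α) ≤ J.toSubmodule := by
  have hn := neg_mem_roots hα
  obtain ⟨⟨a, ha⟩, rfl⟩ := exists_root_eq hα
  have ha0 : a.IsNonZero := by simpa using ha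
  obtain ⟨h, e, f, isSl2, he, hf⟩ :=
    LieAlgebra.IsKilling.exists_isSl2Triple_of_weight_isNonZero ha0
  have heJ : e ∈ J := hJ (by rw [rootSpace_eq_genWeightSpace]; exact he)
  have hhJ : h ∈ J := isSl2.lie_e_f ▸ lie_mem_left ℂ 𝔤 J e f heJ
  have hfJ : ⁅h, f⁆ ∈ J := lie_mem_left ℂ 𝔤 J h f hhJ
  rw [isSl2.lie_h_f_nsmul, neg_mem_iff, ← Nat.cast_smul_eq_nsmul ℂ] at hfJ
  have h2 : f ∈ J.toSubmodule := (Submodule.smul_mem_iff _ (by norm_num)).mp hfJ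
  refine rootSpace_le_of_mem hn ?_ isSl2.f_ne_zero h2
  rw [rootSpace_eq_genWeightSpace]
  exact hf

end RootSpaces

end HarishChandra

/-! ### Positive systems: height induction and independence of the simple roots -/

namespace HarishChandra

section PositiveSystems

open LieAlgebra.IsKilling

variable {𝔤 : Type*} [LieRing 𝔤] [LieAlgebra ℂ 𝔤] [FiniteDimensional ℂ 𝔤]
  [LieAlgebra.IsKilling ℂ 𝔤] {𝔥 : LieSubalgebra ℂ 𝔤} [𝔥.IsCartanSubalgebra]

lemma root_apply_coroot_eq_pairingIn (i j : 𝔥.root) :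
    (rootSystem 𝔥).root i ((rootSystem 𝔥).coroot j) = ((rootSystem 𝔥).pairingIn ℤ i j : ℂ) := by
  have := (rootSystem 𝔥).algebraMap_pairingIn ℤ i j
  rw [eq_intCast] at this
  rw [this]
  rfl

lemma root_add_root_mem_roots {i j : 𝔥.root} (h : (rootSystem 𝔥).pairingIn ℤ i j < 0) :
    (rootSystem 𝔥).root i + (rootSystem 𝔥).root j = 0 ∨
      (rootSystem 𝔥).root i + (rootSystem 𝔥).root j ∈ roots 𝔥 := by
  rw [← range_root_eq]
  by_cases h0 : (rootSystem 𝔥).root i = -(rootSystem 𝔥).root j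
  · exact Or.inl (by rw [h0, neg_add_cancel])
  · exact Or.inr ((rootSystem 𝔥).root_add_root_mem_of_pairingIn_neg h h0)

variable {P : Set (Module.Dual ℂ 𝔥)}

/-- A nonempty sum of positive roots is not zero. -/
lemma IsPositiveSystem.sum_ne_zero (hP : IsPositiveSystem 𝔥 P) (m : Multiset (Module.Dual ℂ 𝔥))
    (hm : ∀ γ ∈ m, γ ∈ P) (h0 : m ≠ 0) : m.sum ≠ 0 := by
  induction hn : m.card using Nat.strong_induction_on generalizing m with
  | _ n ih =>
  intro hsum
  obtain ⟨a, m', rfl⟩ : ∃ a m', m = a ::ₘ m' := by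
    obtain ⟨a, ha⟩ := Multiset.exists_mem_of_ne_zero h0
    exact ⟨a, Multiset.exists_cons_of_mem ha⟩
  have ha : a ∈ P := hm a (Multiset.mem_cons_self a m')
  obtain ⟨i, hi⟩ := exists_root_eq (hP.subset_roots ha)
  -- If no other term paired negatively with the coroot of a, evaluating the sum there would give at
  -- least 2. A term b pairing negatively can be merged with a into one positive root, which
  -- shortens the multiset.
  have key : ∃ b ∈ m', ∃ j, (rootSystem 𝔥).root j = b ∧ (rootSystem 𝔥).pairingIn ℤ j i < 0 := by
    by_contra! hcon
    have hint : ∀ t : Multiset (Module.Dual ℂ 𝔥), (∀ b ∈ t, b ∈ m') →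
        ∃ k : ℤ, 0 ≤ k ∧ t.sum ((rootSystem 𝔥).coroot i) = (k : ℂ) := by
      intro t
      induction t using Multiset.induction_on with
      | empty => exact fun _ => ⟨0, le_rfl, by simp⟩
      | cons b t iht =>
        intro hb
        obtain ⟨k, hk, hk'⟩ := iht fun c hc => hb c (Multiset.mem_cons_of_mem hc)
        have hbm := hb b (Multiset.mem_cons_self b t)
        obtain ⟨j, hj⟩ := exists_root_eq (hP.subset_roots (hm b (Multiset.mem_cons_of_mem hbm)))
        refine ⟨(rootSystem 𝔥).pairingIn ℤ j i + k, add_nonneg (hcon b hbm j hj) hk, ?_⟩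
        rw [Multiset.sum_cons, LinearMap.add_apply, hk', ← hj, root_apply_coroot_eq_pairingIn]
        push_cast
        rfl
    obtain ⟨k, hk, hk'⟩ := hint m' fun _ h => h
    have h2 := congrArg (fun f : Module.Dual ℂ 𝔥 => f ((rootSystem 𝔥).coroot i)) hsum
    simp only [Multiset.sum_cons, LinearMap.add_apply, LinearMap.zero_apply] at h2
    rw [hk', ← hi, root_apply_coroot_eq_pairingIn] at h2
    have h3 : (rootSystem 𝔥).pairingIn ℤ i i = 2 := by simp
    rw [h3] at h2
    have h4 : (2 : ℤ) + k = 0 := by exact_mod_cast h2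
    omega
  obtain ⟨b, hb, j, hj, hneg⟩ := key
  have hbP : b ∈ P := hm b (Multiset.mem_cons_of_mem hb)
  obtain ⟨m'', rfl⟩ := Multiset.exists_cons_of_mem hb
  have habP : b + a ∈ P := by
    rcases root_add_root_mem_roots hneg with h | h
    · rw [hi, hj] at h
      refine absurd ?_ (hP.neg_notMem a ha)
      rwa [← eq_neg_of_add_eq_zero_left h]
    · rw [hi, hj] at h
      exact hP.add_mem b hbP a ha h
  refine ih (m''.card + 1) (by simp at hn; omega) ((b + a) ::ₘ m'') ?_ (Multiset.cons_ne_zero)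
    (by simp) ?_
  · intro γ hγ
    rcases Multiset.mem_cons.mp hγ with rfl | h
    · exact habP
    · exact hm γ (Multiset.mem_cons_of_mem (Multiset.mem_cons_of_mem h))
  · simp only [Multiset.sum_cons] at hsum ⊢
    rw [← hsum]
    abel

lemma IsPositiveSystem.add_ne_zero_of_mem_closure (hP : IsPositiveSystem 𝔥 P)
    {γ c : Module.Dual ℂ 𝔥} (hγ : γ ∈ P) (hc : c ∈ AddSubmonoid.closure P) : γ + c ≠ 0 := by
  obtain ⟨m, hm, rfl⟩ := AddSubmonoid.exists_multiset_of_mem_closure hc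
  have := hP.sum_ne_zero (γ ::ₘ m) (by
    intro δ hδ
    rcases Multiset.mem_cons.mp hδ with rfl | h
    · exact hγ
    · exact hm δ h) Multiset.cons_ne_zero
  simpa using this

lemma IsPositiveSystem.finite (hP : IsPositiveSystem 𝔥 P) : P.Finite :=
  (finite_roots 𝔥).subset hP.subset_roots

/-- Induction over a positive system: it is enough to treat simple roots and sums. -/
lemma IsPositiveSystem.induction (hP : IsPositiveSystem 𝔥 P) {p : Module.Dual ℂ 𝔥 → Prop}
    (hsimple : ∀ γ ∈ simpleRoots P, p γ)
    (hadd : ∀ β ∈ P, ∀ γ ∈ P, β + γ ∈ P → p β → p γ → p (β + γ)) :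
    ∀ γ ∈ P, p γ := by
  -- The number of positive roots below γ serves as a height: it is defined without reference to
  -- simple roots, and it increases strictly when a positive root is added.
  let D : Module.Dual ℂ 𝔥 → Set (Module.Dual ℂ 𝔥) :=
    fun γ => {δ | δ ∈ P ∧ γ - δ ∈ AddSubmonoid.closure P}
  have hD : ∀ γ ∈ P, ∀ δ ∈ P, (D γ).ncard < (D (γ + δ)).ncard ∨ γ + δ ∉ P := by
    intro γ hγ δ hδ
    by_cases h : γ + δ ∈ P
    · left
      refine Set.ncard_lt_ncard ⟨fun x hx => ⟨hx.1, ?_⟩, fun hsub => ?_⟩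
        (hP.finite.subset fun x hx => hx.1)
      · have : γ + δ - x = (γ - x) + δ := by abel
        rw [this]
        exact AddMemClass.add_mem hx.2 (AddSubmonoid.subset_closure hδ)
      · have h1 : γ + δ ∈ D γ := hsub ⟨h, by simp⟩
        have h2 : γ - (γ + δ) ∈ AddSubmonoid.closure P := h1.2
        exact hP.add_ne_zero_of_mem_closure hδ h2 (by abel)
    · exact Or.inr h
  intro γ hγ
  induction hn : (D γ).ncard using Nat.strong_induction_on generalizing γ with
  | _ n ih =>
  by_cases hs : γ ∈ simpleRoots P
  · exact hsimple γ hs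
  · have : ∃ β ∈ P, ∃ δ ∈ P, γ = β + δ := by
      by_contra! hcon
      exact hs ⟨hγ, hcon⟩
    obtain ⟨β, hβ, δ, hδ, rfl⟩ := this
    have h1 := (hD β hβ δ hδ).resolve_right (fun h => h hγ)
    have h2 := (hD δ hδ β hβ).resolve_right (fun h => h (by rwa [add_comm]))
    rw [add_comm δ β] at h2
    exact hadd β hβ δ hδ hγ (ih _ (hn ▸ h1) β hβ rfl) (ih _ (hn ▸ h2) δ hδ rfl)

lemma IsPositiveSystem.mem_closure_simpleRoots (hP : IsPositiveSystem 𝔥 P) {γ : Module.Dual ℂ 𝔥}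
    (hγ : γ ∈ P) : γ ∈ AddSubmonoid.closure (simpleRoots P) :=
  hP.induction (fun _ h => AddSubmonoid.subset_closure h)
    (fun _ _ _ _ _ h1 h2 => AddMemClass.add_mem h1 h2) γ hγ

lemma IsPositiveSystem.span_simpleRoots (hP : IsPositiveSystem 𝔥 P) :
    Submodule.span ℂ (simpleRoots P) = ⊤ := by
  have hle : AddSubmonoid.closure (simpleRoots P) ≤
      (Submodule.span ℂ (simpleRoots P)).toAddSubmonoid :=
    AddSubmonoid.closure_le.mpr Submodule.subset_span
  rw [eq_top_iff, ← RootPairing.IsRootSystem.span_root_eq_top (P := rootSystem 𝔥), range_root_eq,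
    Submodule.span_le]
  intro γ hγ
  rcases hP.mem_or_neg_mem γ hγ with h | h
  · exact hle (hP.mem_closure_simpleRoots h)
  · have := hle (hP.mem_closure_simpleRoots h)
    exact (neg_mem_iff (S := Submodule ℂ (Module.Dual ℂ 𝔥))).mp this

/-- A positive pairing would make the difference a root; whichever sign of it is positive then
writes one of the two simple roots as a sum. -/
lemma pairingIn_le_zero_of_simpleRoots (hP : IsPositiveSystem 𝔥 P) {i j : 𝔥.root}
    (hi : (rootSystem 𝔥).root i ∈ simpleRoots P) (hj : (rootSystem 𝔥).root j ∈ simpleRoots P)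
    (hij : i ≠ j) : (rootSystem 𝔥).pairingIn ℤ i j ≤ 0 := by
  by_contra! h
  have h1 := (rootSystem 𝔥).root_sub_root_mem_of_pairingIn_pos h hij
  rw [range_root_eq] at h1
  rcases hP.mem_or_neg_mem _ h1 with h2 | h2
  · exact hi.2 _ h2 _ hj.1 (by abel)
  · exact hj.2 _ h2 _ hi.1 (by abel)

/-- The matrix `∑ₖ ⟨αᵢ, αₖ^∨⟩ ⟨αⱼ, αₖ^∨⟩` of the canonical form on the roots. -/
lemma sum_pairingIn_mul_le_zero {i j : 𝔥.root} (h : (rootSystem 𝔥).pairingIn ℤ i j ≤ 0) :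
    ∑ k, (rootSystem 𝔥).pairingIn ℤ i k * (rootSystem 𝔥).pairingIn ℤ j k ≤ 0 := by
  have hB : ∀ i j : 𝔥.root, (rootSystem 𝔥).RootForm ((rootSystem 𝔥).root i)
      ((rootSystem 𝔥).root j) =
      ((∑ k, (rootSystem 𝔥).pairingIn ℤ i k * (rootSystem 𝔥).pairingIn ℤ j k : ℤ) : ℂ) := by
    intro i j
    rw [RootPairing.rootForm_apply_apply]
    push_cast
    refine Finset.sum_congr rfl fun k _ => ?_
    rw [← root_apply_coroot_eq_pairingIn, ← root_apply_coroot_eq_pairingIn]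
    rfl
  -- Invariance gives 2(αᵢ, αⱼ) = ⟨αᵢ, αⱼ^∨⟩(αⱼ, αⱼ), and (αⱼ, αⱼ) is a sum of squares, so the form
  -- has the sign of the pairing.
  have h2 := (rootSystem 𝔥).toInvariantForm.two_mul_apply_root_root i j
  have h3 : 2 * (∑ k, (rootSystem 𝔥).pairingIn ℤ i k * (rootSystem 𝔥).pairingIn ℤ j k) =
      (rootSystem 𝔥).pairingIn ℤ i j *
        ∑ k, (rootSystem 𝔥).pairingIn ℤ j k * (rootSystem 𝔥).pairingIn ℤ j k := by
    have h4 : (rootSystem 𝔥).pairing i j = ((rootSystem 𝔥).pairingIn ℤ i j : ℂ) := by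
      rw [← root_apply_coroot_eq_pairingIn]; rfl
    change 2 * (rootSystem 𝔥).RootForm _ _ = _ * (rootSystem 𝔥).RootForm _ _ at h2
    rw [hB, hB, h4] at h2
    exact_mod_cast h2
  have h5 : 0 ≤ ∑ k, (rootSystem 𝔥).pairingIn ℤ j k * (rootSystem 𝔥).pairingIn ℤ j k :=
    Finset.sum_nonneg fun k _ => mul_self_nonneg _
  nlinarith

lemma eq_zero_of_forall_coroot {γ : Module.Dual ℂ 𝔥}
    (h : ∀ k, γ ((rootSystem 𝔥).coroot k) = 0) : γ = 0 := by
  refine LinearMap.ext fun x => ?_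
  have hx : x ∈ Submodule.span ℂ (Set.range (rootSystem 𝔥).coroot) := by
    rw [RootPairing.IsRootSystem.span_coroot_eq_top]; trivial
  induction hx using Submodule.span_induction with
  | mem x hx => obtain ⟨k, rfl⟩ := hx; exact h k
  | zero => simp
  | add x y _ _ hx hy => simpa [hx] using hy
  | smul c x _ hx => simp [hx]

lemma IsPositiveSystem.eq_zero_of_nat_sum (hP : IsPositiveSystem 𝔥 P) (T : Finset 𝔥.root)
    (hT : ∀ i ∈ T, (rootSystem 𝔥).root i ∈ P) (c : 𝔥.root → ℕ)
    (h : ∑ i ∈ T, c i • (rootSystem 𝔥).root i = 0) : ∀ i ∈ T, c i = 0 := by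
  classical
  intro i hi
  by_contra h0
  obtain ⟨n, hn⟩ := Nat.exists_eq_succ_of_ne_zero h0
  rw [← Finset.add_sum_erase T _ hi, hn, succ_nsmul', add_assoc] at h
  refine hP.add_ne_zero_of_mem_closure (hT i hi) (AddMemClass.add_mem ?_ (sum_mem fun j hj => ?_)) h
  · exact nsmul_mem (AddSubmonoid.subset_closure (hT i hi)) n
  · exact nsmul_mem (AddSubmonoid.subset_closure (hT j (Finset.mem_of_mem_erase hj))) _

/-- The classical obtuseness argument: move the negative coefficients to the other side, so that
both sides are the same vector v. Its square is a combination, with nonnegative coefficients, of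
products of distinct simple roots, hence at most 0. So v = 0, and a nonnegative combination of
positive roots vanishes only trivially. -/
lemma IsPositiveSystem.eq_zero_of_int_sum (hP : IsPositiveSystem 𝔥 P) (T : Finset 𝔥.root)
    (hT : ∀ i ∈ T, (rootSystem 𝔥).root i ∈ simpleRoots P) (c : 𝔥.root → ℤ)
    (h : ∀ k, ∑ i ∈ T, c i * (rootSystem 𝔥).pairingIn ℤ i k = 0) : ∀ i ∈ T, c i = 0 := by
  have hsplit : ∀ i, c i = (c i).toNat - (-c i).toNat := fun i => by omega
  have heq : ∀ k, ∑ i ∈ T, ((c i).toNat : ℤ) * (rootSystem 𝔥).pairingIn ℤ i k =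
      ∑ i ∈ T, ((-c i).toNat : ℤ) * (rootSystem 𝔥).pairingIn ℤ i k := by
    intro k
    rw [← sub_eq_zero, ← Finset.sum_sub_distrib, ← h k]
    refine Finset.sum_congr rfl fun i _ => ?_
    rw [← sub_mul, ← hsplit]
  have hsq : ∑ k, (∑ i ∈ T, ((c i).toNat : ℤ) * (rootSystem 𝔥).pairingIn ℤ i k) *
      (∑ i ∈ T, ((c i).toNat : ℤ) * (rootSystem 𝔥).pairingIn ℤ i k) ≤ 0 := by
    have e : ∑ k, (∑ i ∈ T, ((c i).toNat : ℤ) * (rootSystem 𝔥).pairingIn ℤ i k) *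
        (∑ i ∈ T, ((c i).toNat : ℤ) * (rootSystem 𝔥).pairingIn ℤ i k) =
        ∑ i ∈ T, ∑ j ∈ T, ((c i).toNat : ℤ) * ((-c j).toNat : ℤ) *
          ∑ k, (rootSystem 𝔥).pairingIn ℤ i k * (rootSystem 𝔥).pairingIn ℤ j k := by
      simp_rw [Finset.mul_sum]
      have : ∀ k, (∑ i ∈ T, ((c i).toNat : ℤ) * (rootSystem 𝔥).pairingIn ℤ i k) *
          (∑ i ∈ T, ((c i).toNat : ℤ) * (rootSystem 𝔥).pairingIn ℤ i k) =
          ∑ i ∈ T, ∑ j ∈ T, ((c i).toNat : ℤ) * ((-c j).toNat : ℤ) *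
            ((rootSystem 𝔥).pairingIn ℤ i k * (rootSystem 𝔥).pairingIn ℤ j k) := by
        intro k
        -- Only one factor is rewritten, so that positive parts are paired with negative parts.
        nth_rewrite 2 [heq k]
        rw [Finset.sum_mul_sum]
        exact Finset.sum_congr rfl fun i _ => Finset.sum_congr rfl fun j _ => by ring
      simp_rw [← Finset.mul_sum]
      rw [Finset.sum_congr rfl fun k _ => this k, Finset.sum_comm]
      refine Finset.sum_congr rfl fun i _ => ?_
      rw [Finset.sum_comm]
      exact Finset.sum_congr rfl fun j _ => by rw [Finset.mul_sum]
    rw [e]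
    refine Finset.sum_nonpos fun i hi => Finset.sum_nonpos fun j hj => ?_
    -- On the diagonal one of the two parts of the same integer is zero.
    by_cases hij : i = j
    · subst hij
      rcases le_total 0 (c i) with h0 | h0
      · have : (-c i).toNat = 0 := by omega
        simp [this]
      · have : (c i).toNat = 0 := by omega
        simp [this]
    · exact mul_nonpos_of_nonneg_of_nonpos (by positivity) (sum_pairingIn_mul_le_zero
        (pairingIn_le_zero_of_simpleRoots hP (hT i hi) (hT j hj) hij))
  have hk : ∀ k, ∑ i ∈ T, ((c i).toNat : ℤ) * (rootSystem 𝔥).pairingIn ℤ i k = 0 := by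
    intro k
    have h0 := le_antisymm hsq (Finset.sum_nonneg fun k _ => mul_self_nonneg _)
    rw [Finset.sum_eq_zero_iff_of_nonneg fun k _ => mul_self_nonneg _] at h0
    exact mul_self_eq_zero.mp (h0 k (Finset.mem_univ k))
  have hnat : ∀ d : 𝔥.root → ℕ, (∀ k, ∑ i ∈ T, (d i : ℤ) * (rootSystem 𝔥).pairingIn ℤ i k = 0) →
      ∀ i ∈ T, d i = 0 := by
    intro d hd
    refine hP.eq_zero_of_nat_sum T (fun i hi => (hT i hi).1) d
      (eq_zero_of_forall_coroot fun k => ?_)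
    rw [LinearMap.sum_apply]
    have := congrArg (Int.cast (R := ℂ)) (hd k)
    push_cast at this
    rw [← this]
    refine Finset.sum_congr rfl fun i _ => ?_
    rw [LinearMap.smul_apply, root_apply_coroot_eq_pairingIn, nsmul_eq_mul]
  intro i hi
  have h1 := hnat _ hk i hi
  have h2 := hnat (fun i => (-c i).toNat) (fun k => (heq k).symm.trans (hk k)) i hi
  have h3 : (-c i).toNat = 0 := h2
  rw [hsplit i, h1, h3]
  rfl

lemma IsPositiveSystem.eq_zero_of_rat_sum (hP : IsPositiveSystem 𝔥 P) (T : Finset 𝔥.root)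
    (hT : ∀ i ∈ T, (rootSystem 𝔥).root i ∈ simpleRoots P) (c : 𝔥.root → ℚ)
    (h : ∀ k, ∑ i ∈ T, c i * (rootSystem 𝔥).pairingIn ℤ i k = 0) : ∀ i ∈ T, c i = 0 := by
  obtain ⟨b, hb⟩ := IsLocalization.exist_integer_multiples_of_finset (nonZeroDivisors ℤ)
    (Finset.univ.image c)
  have hb' : ∀ i, ∃ z : ℤ, (z : ℚ) = (b : ℤ) * c i := by
    intro i
    obtain ⟨z, hz⟩ := hb (c i) (Finset.mem_image_of_mem c (Finset.mem_univ i))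
    exact ⟨z, by simpa using hz⟩
  choose z hz using hb'
  have hb0 : ((b : ℤ) : ℚ) ≠ 0 := by exact_mod_cast nonZeroDivisors.ne_zero b.2
  have h1 := hP.eq_zero_of_int_sum T hT z fun k => by
    have : ((∑ i ∈ T, z i * (rootSystem 𝔥).pairingIn ℤ i k : ℤ) : ℚ) = 0 := by
      push_cast
      simp_rw [hz, mul_assoc]
      rw [← Finset.mul_sum, h k, mul_zero]
    exact_mod_cast this
  intro i hi
  have h2 := hz i
  rw [h1 i hi, Int.cast_zero] at h2
  exact (mul_eq_zero.mp h2.symm).resolve_left hb0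

/-- The simple roots of a positive system are linearly independent. -/
lemma IsPositiveSystem.linearIndepOn_simpleRoots (hP : IsPositiveSystem 𝔥 P) :
    LinearIndepOn ℂ id (simpleRoots P) := by
  have hind : LinearIndepOn ℂ (rootSystem 𝔥).root
      {i | (rootSystem 𝔥).root i ∈ simpleRoots P} := by
    rw [linearIndepOn_iff']
    intro T g hT hg i hi
    -- Descent from ℂ to ℚ: the pairings are integers, so every ℚ-linear functional on ℂ turns the
    -- relation into a rational one.
    rw [← Module.forall_dual_apply_eq_zero_iff ℚ]
    intro φ
    refine hP.eq_zero_of_rat_sum T (fun j hj => hT hj) (fun j => φ (g j)) (fun k => ?_) i hi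
    have h1 := congrArg (fun f : Module.Dual ℂ 𝔥 => φ (f ((rootSystem 𝔥).coroot k))) hg
    simp only [LinearMap.sum_apply, LinearMap.smul_apply, root_apply_coroot_eq_pairingIn,
      LinearMap.zero_apply, map_zero, map_sum, smul_eq_mul] at h1
    rw [← h1]
    refine Finset.sum_congr rfl fun j _ => ?_
    rw [mul_comm (g j), ← zsmul_eq_mul, map_zsmul, zsmul_eq_mul, mul_comm]
  have := hind.id_image
  convert this using 1
  ext γ
  refine ⟨fun h => ?_, by rintro ⟨i, hi, rfl⟩; exact hi⟩
  obtain ⟨i, rfl⟩ := exists_root_eq (hP.subset_roots h.1)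
  exact ⟨i, h, rfl⟩

lemma IsPositiveSystem.ncard_simpleRoots (hP : IsPositiveSystem 𝔥 P) :
    (simpleRoots P).ncard = Module.finrank ℂ 𝔥 := by
  have b : Module.Basis (simpleRoots P) ℂ (Module.Dual ℂ 𝔥) :=
    Module.Basis.mk hP.linearIndepOn_simpleRoots (by
      have : Set.range (fun γ : simpleRoots P => id (γ : Module.Dual ℂ 𝔥)) = simpleRoots P := by
        simp
      rw [this, hP.span_simpleRoots])
  rw [← Nat.card_coe_set_eq, ← Module.finrank_eq_nat_card_basis b, Subspace.dual_finrank_eq]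

end PositiveSystems

end HarishChandra

/-! ### Compact and non-compact root spaces -/

namespace HarishChandra

section Parity

variable {𝔤 : Type*} [LieRing 𝔤] [LieAlgebra ℂ 𝔤] {θ : 𝔤 ≃ₗ⁅ℂ⁆ 𝔤}

lemma mem_kk {x : 𝔤} : x ∈ kk θ ↔ θ x = x := Iff.rfl

lemma mem_pp {x : 𝔤} : x ∈ pp θ ↔ θ x = -x := Iff.rfl

lemma lie_mem_pp_of_kk {x y : 𝔤} (hx : x ∈ kk θ) (hy : y ∈ pp θ) : ⁅x, y⁆ ∈ pp θ := by
  rw [mem_kk] at hx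
  rw [mem_pp] at *
  rw [LieEquiv.map_lie, hx, hy, lie_neg]

lemma lie_mem_kk_of_pp {x y : 𝔤} (hx : x ∈ pp θ) (hy : y ∈ pp θ) : ⁅x, y⁆ ∈ kk θ := by
  rw [mem_kk]
  rw [mem_pp] at *
  rw [LieEquiv.map_lie, hx, hy, neg_lie, lie_neg, neg_neg]

lemma eq_zero_of_mem_kk_of_mem_pp {x : 𝔤} (hk : x ∈ kk θ) (hp : x ∈ pp θ) : x = 0 := by
  rw [mem_kk] at hk
  rw [mem_pp, hk] at hp
  have h2 : (2 : ℂ) • x = 0 := by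
    rw [two_smul]
    nth_rewrite 2 [hp]
    exact add_neg_cancel x
  exact (smul_eq_zero.mp h2).resolve_left two_ne_zero

lemma disjoint_kk_pp : Disjoint (kk θ).toSubmodule (pp θ) := by
  rw [Submodule.disjoint_def]
  exact fun x hk hp => eq_zero_of_mem_kk_of_mem_pp hk hp

variable {𝔥 : LieSubalgebra ℂ 𝔤}

lemma map_mem_rootSpace (h_le : 𝔥 ≤ kk θ) {γ : Module.Dual ℂ 𝔥} {x : 𝔤}
    (hx : x ∈ rootSpace 𝔥 γ) : θ x ∈ rootSpace 𝔥 γ := by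
  rw [mem_rootSpace] at *
  intro H
  have h1 : θ (H : 𝔤) = H := h_le H.2
  rw [← map_smul, ← hx H, LieEquiv.map_lie, h1]

lemma not_rootSpace_le_kk_and_pp {γ : Module.Dual ℂ 𝔥} (h : γ ∈ roots 𝔥)
    (hk : rootSpace 𝔥 γ ≤ (kk θ).toSubmodule) (hp : rootSpace 𝔥 γ ≤ pp θ) : False := by
  obtain ⟨x, hx, h0⟩ := exists_ne_zero_of_mem_roots h
  exact h0 (eq_zero_of_mem_kk_of_mem_pp (hk hx) (hp hx))

variable [FiniteDimensional ℂ 𝔤] [LieAlgebra.IsKilling ℂ 𝔤] [𝔥.IsCartanSubalgebra]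

/-- For x in 𝔤_γ the vector x + θx lies in 𝔨 ∩ 𝔤_γ; if that intersection is zero, θ acts on 𝔤_γ by
-1. -/
lemma rootSpace_le_kk_or_pp (hinv : ∀ x, θ (θ x) = x) (h_le : 𝔥 ≤ kk θ) {γ : Module.Dual ℂ 𝔥}
    (h : γ ∈ roots 𝔥) : rootSpace 𝔥 γ ≤ (kk θ).toSubmodule ∨ rootSpace 𝔥 γ ≤ pp θ := by
  refine (inf_eq_bot_or_rootSpace_le h (kk θ).toSubmodule).symm.imp_right fun hb x hx => ?_
  have h1 : x + θ x ∈ (kk θ).toSubmodule ⊓ rootSpace 𝔥 γ :=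
    ⟨show θ (x + θ x) = x + θ x by rw [map_add, hinv, add_comm],
      add_mem hx (map_mem_rootSpace h_le hx)⟩
  rw [hb, Submodule.mem_bot] at h1
  exact mem_pp.mpr (eq_neg_of_add_eq_zero_right h1)

/-- The nonzero bracket of 𝔤_γ with 𝔤_{-γ} lies in 𝔥 ⊆ 𝔨, but would lie in 𝔭 if -γ had the other
parity. -/
lemma rootSpace_neg_le_kk (hinv : ∀ x, θ (θ x) = x) (h_le : 𝔥 ≤ kk θ) {γ : Module.Dual ℂ 𝔥}
    (h : γ ∈ roots 𝔥) (hk : rootSpace 𝔥 γ ≤ (kk θ).toSubmodule) :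
    rootSpace 𝔥 (-γ) ≤ (kk θ).toSubmodule := by
  refine (rootSpace_le_kk_or_pp hinv h_le (neg_mem_roots h)).resolve_right fun hp => ?_
  obtain ⟨x, hx, y, hy, h0⟩ := exists_lie_neg_ne_zero h
  have h1 := lie_mem_rootSpace_add hx hy
  rw [add_neg_cancel, rootSpace_zero] at h1
  exact h0 (eq_zero_of_mem_kk_of_mem_pp (h_le h1) (lie_mem_pp_of_kk (hk hx) (hp hy)))

lemma rootSpace_neg_le_pp (hinv : ∀ x, θ (θ x) = x) (h_le : 𝔥 ≤ kk θ) {γ : Module.Dual ℂ 𝔥}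
    (h : γ ∈ roots 𝔥) (hp : rootSpace 𝔥 γ ≤ pp θ) : rootSpace 𝔥 (-γ) ≤ pp θ := by
  refine (rootSpace_le_kk_or_pp hinv h_le (neg_mem_roots h)).resolve_left fun hk => ?_
  have := rootSpace_neg_le_kk hinv h_le (neg_mem_roots h) hk
  rw [neg_neg] at this
  exact not_rootSpace_le_kk_and_pp h this hp

/-- `𝔨` is spanned by `𝔥` and the compact root spaces. -/
lemma kk_le (h_le : 𝔥 ≤ kk θ) {N : Submodule ℂ 𝔤} (h0 : 𝔥.toSubmodule ≤ N)
    (h : ∀ α ∈ roots 𝔥, rootSpace 𝔥 α ≤ (kk θ).toSubmodule → rootSpace 𝔥 α ≤ N) :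
    (kk θ).toSubmodule ≤ N := by
  rw [eq_iSup_inf_rootSpace (𝔥 := 𝔥) (kk θ).toSubmodule
    fun H hH x hx => (kk θ).lie_mem (h_le hH) hx]
  refine iSup_le fun γ => ?_
  by_cases hγ0 : γ = 0
  · subst hγ0
    exact inf_le_right.trans (rootSpace_zero.le.trans h0)
  by_cases hγ : rootSpace 𝔥 γ = ⊥
  · rw [hγ]; simp
  rcases inf_eq_bot_or_rootSpace_le ⟨hγ0, hγ⟩ (kk θ).toSubmodule with h1 | h1
  · rw [h1]; exact bot_le
  · exact inf_le_right.trans (h γ ⟨hγ0, hγ⟩ h1)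

/-- A sum of root spaces is stable under `𝔨` if its set of roots is stable under the addition of
compact roots. -/
lemma lie_mem_rootSum (h_le : 𝔥 ≤ kk θ) {Q : Set (Module.Dual ℂ 𝔥)}
    (hQ : ∀ γ ∈ Q, ∀ α ∈ roots 𝔥, rootSpace 𝔥 α ≤ (kk θ).toSubmodule →
      rootSpace 𝔥 (α + γ) ≠ ⊥ → α + γ ∈ Q) {x y : 𝔤} (hx : x ∈ kk θ) (hy : y ∈ rootSum Q) :
    ⁅x, y⁆ ∈ rootSum Q := by
  -- The stabilizer of the sum is a subspace, so it suffices that it contains 𝔥 and every compact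
  -- root space.
  let N : Submodule ℂ 𝔤 :=
    { carrier := {x | ∀ y ∈ rootSum Q, ⁅x, y⁆ ∈ rootSum Q}
      add_mem' := fun {a b} ha hb y hy => by rw [add_lie]; exact add_mem (ha y hy) (hb y hy)
      zero_mem' := fun y _ => by rw [zero_lie]; exact zero_mem _
      smul_mem' := fun c a ha y hy => by rw [smul_lie]; exact Submodule.smul_mem _ _ (ha y hy) }
  have hN : ∀ x, (∀ γ ∈ Q, ∀ y ∈ rootSpace 𝔥 γ, ⁅x, y⁆ ∈ rootSum Q) → x ∈ N := by
    intro x hx y hy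
    have : rootSum Q ≤ (rootSum Q).comap (LieAlgebra.ad ℂ 𝔤 x) :=
      rootSum_le fun γ hγ y hy => hx γ hγ y hy
    exact this hy
  refine kk_le (N := N) h_le (fun H hH => hN H fun γ hγ y hy => ?_)
    (fun α hα hαk x hx => hN x fun γ hγ y hy => ?_) hx y hy
  · have := mem_rootSpace.mp hy ⟨H, hH⟩
    rw [this]
    exact Submodule.smul_mem _ _ (rootSpace_le_rootSum hγ hy)
  · have h1 := lie_mem_rootSpace_add hx hy
    by_cases hb : rootSpace 𝔥 (α + γ) = ⊥
    · rw [hb, Submodule.mem_bot] at h1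
      rw [h1]
      exact zero_mem _
    · exact rootSpace_le_rootSum (hQ γ hγ α hα hαk hb) h1

end Parity

end HarishChandra

/-! ### Additive behaviour of compact and non-compact roots under total positivity -/

namespace HarishChandra

/-- An involution `θ` fixing `𝔥` and a positive system all of whose non-compact elements are totally
positive. -/
structure IsTotallyPositive {𝔤 : Type*} [LieRing 𝔤] [LieAlgebra ℂ 𝔤] (θ : 𝔤 ≃ₗ⁅ℂ⁆ 𝔤)
    {𝔥 : LieSubalgebra ℂ 𝔤} (P : Set (Module.Dual ℂ 𝔥)) : Prop where
  involutive : ∀ x, θ (θ x) = x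
  cartan_le : 𝔥 ≤ kk θ
  positive : IsPositiveSystem 𝔥 P
  total : noncompactRoots θ P = totallyPositiveRoots θ P

/-- The non-compact simple roots. -/
def noncompactSimpleRoots {𝔤 : Type*} [LieRing 𝔤] [LieAlgebra ℂ 𝔤] (θ : 𝔤 ≃ₗ⁅ℂ⁆ 𝔤)
    {𝔥 : LieSubalgebra ℂ 𝔤} (P : Set (Module.Dual ℂ 𝔥)) : Set (Module.Dual ℂ 𝔥) :=
  simpleRoots P ∩ noncompactRoots θ P

/-- The positive non-compact roots congruent to `β` modulo the span of the compact roots. -/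
def pieceRoots {𝔤 : Type*} [LieRing 𝔤] [LieAlgebra ℂ 𝔤] (θ : 𝔤 ≃ₗ⁅ℂ⁆ 𝔤)
    {𝔥 : LieSubalgebra ℂ 𝔤} (P : Set (Module.Dual ℂ 𝔥)) (β : Module.Dual ℂ 𝔥) :
    Set (Module.Dual ℂ 𝔥) :=
  {γ | γ ∈ noncompactRoots θ P ∧ γ - β ∈ Submodule.span ℂ (simpleRoots (compactRoots θ P))}

/-- The sum of the root spaces of the roots in `pieceRoots θ P β`. -/
noncomputable def piece {𝔤 : Type*} [LieRing 𝔤] [LieAlgebra ℂ 𝔤] (θ : 𝔤 ≃ₗ⁅ℂ⁆ 𝔤)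
    {𝔥 : LieSubalgebra ℂ 𝔤} (P : Set (Module.Dual ℂ 𝔥)) (β : Module.Dual ℂ 𝔥) : Submodule ℂ 𝔤 :=
  rootSum (pieceRoots θ P β)

namespace IsTotallyPositive

variable {𝔤 : Type*} [LieRing 𝔤] [LieAlgebra ℂ 𝔤] {θ : 𝔤 ≃ₗ⁅ℂ⁆ 𝔤} {𝔥 : LieSubalgebra ℂ 𝔤}
  {P : Set (Module.Dual ℂ 𝔥)}

/-- Each root space of 𝔭⁺ sits in some 𝔨-submodule contained in 𝔭⁺, so 𝔭⁺ is a sum of such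
submodules. -/
lemma lie_mem_pPlus (h : IsTotallyPositive θ P) {x y : 𝔤} (hx : x ∈ kk θ) (hy : y ∈ pPlus θ P) :
    ⁅x, y⁆ ∈ pPlus θ P := by
  have : pPlus θ P ≤ (pPlus θ P).comap (LieAlgebra.ad ℂ 𝔤 x) := by
    refine rootSum_le fun γ hγ y hy => ?_
    rw [h.total] at hγ
    obtain ⟨-, m, hm, hγm⟩ := hγ
    exact hm (m.lie_mem (x := ⟨x, hx⟩) (hγm hy))
  exact this hy

variable [FiniteDimensional ℂ 𝔤] [LieAlgebra.IsKilling ℂ 𝔤] [𝔥.IsCartanSubalgebra]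

lemma compact_or_noncompact (h : IsTotallyPositive θ P) {γ : Module.Dual ℂ 𝔥} (hγ : γ ∈ P) :
    γ ∈ compactRoots θ P ∨ γ ∈ noncompactRoots θ P :=
  (rootSpace_le_kk_or_pp h.involutive h.cartan_le (h.positive.subset_roots hγ)).imp
    (fun h => ⟨hγ, h⟩) (fun h => ⟨hγ, h⟩)

omit [FiniteDimensional ℂ 𝔤] [LieAlgebra.IsKilling ℂ 𝔤] [𝔥.IsCartanSubalgebra] in
lemma not_compact_and_noncompact (h : IsTotallyPositive θ P) {γ : Module.Dual ℂ 𝔥}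
    (hk : γ ∈ compactRoots θ P) (hn : γ ∈ noncompactRoots θ P) : False :=
  not_rootSpace_le_kk_and_pp (h.positive.subset_roots hk.1) hk.2 hn.2

/-- Stability of 𝔭⁺ read off on roots. The compact root α may be negative, so compact roots can also
be subtracted. -/
lemma add_mem_noncompactRoots (h : IsTotallyPositive θ P) {α γ : Module.Dual ℂ 𝔥}
    (hα : α ∈ roots 𝔥) (hαk : rootSpace 𝔥 α ≤ (kk θ).toSubmodule)
    (hγ : γ ∈ noncompactRoots θ P) (hαγ : α + γ ∈ roots 𝔥) : α + γ ∈ noncompactRoots θ P :=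
  mem_of_rootSpace_le_rootSum hαγ <| rootSpace_add_le hα (h.positive.subset_roots hγ.1) hαγ
    fun _ hx _ hy => h.lie_mem_pPlus (hαk hx) (rootSpace_le_rootSum hγ hy)

lemma neg_compact (h : IsTotallyPositive θ P) {γ : Module.Dual ℂ 𝔥}
    (hγ : γ ∈ compactRoots θ P) :
    -γ ∈ roots 𝔥 ∧ rootSpace 𝔥 (-γ) ≤ (kk θ).toSubmodule :=
  ⟨neg_mem_roots (h.positive.subset_roots hγ.1),
    rootSpace_neg_le_kk h.involutive h.cartan_le (h.positive.subset_roots hγ.1) hγ.2⟩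

/-- Such a sum would be a compact root, since [𝔭, 𝔭] ⊆ 𝔨. Adding its negative to γ would then put -β
in P_n, impossible as β is positive. -/
lemma add_notMem_roots (h : IsTotallyPositive θ P) {β γ : Module.Dual ℂ 𝔥}
    (hβ : β ∈ noncompactRoots θ P) (hγ : γ ∈ noncompactRoots θ P) : β + γ ∉ roots 𝔥 := by
  intro hr
  have hP : β + γ ∈ P := h.positive.add_mem β hβ.1 γ hγ.1 hr
  have hk : β + γ ∈ compactRoots θ P :=
    ⟨hP, rootSpace_add_le (h.positive.subset_roots hβ.1) (h.positive.subset_roots hγ.1) hr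
      fun x hx y hy => lie_mem_kk_of_pp (hβ.2 hx) (hγ.2 hy)⟩
  obtain ⟨h1, h2⟩ := h.neg_compact hk
  have e : -(β + γ) + γ = -β := by abel
  have h3 := h.add_mem_noncompactRoots h1 h2 hγ
    (e ▸ neg_mem_roots (h.positive.subset_roots hβ.1))
  rw [e] at h3
  exact h.positive.neg_notMem β hβ.1 h3.1

omit [FiniteDimensional ℂ 𝔤] [LieAlgebra.IsKilling ℂ 𝔤] [𝔥.IsCartanSubalgebra] in
lemma add_ne_zero (h : IsTotallyPositive θ P) {β γ : Module.Dual ℂ 𝔥}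
    (hβ : β ∈ P) (hγ : γ ∈ P) : β + γ ≠ 0 := fun h0 =>
  h.positive.neg_notMem γ hγ (by rwa [← eq_neg_of_add_eq_zero_left h0])

lemma lie_eq_zero_of_pPlus (h : IsTotallyPositive θ P) {x y : 𝔤} (hx : x ∈ pPlus θ P)
    (hy : y ∈ pPlus θ P) : ⁅x, y⁆ = 0 := by
  have h1 : ∀ γ ∈ noncompactRoots θ P, ∀ y ∈ rootSpace 𝔥 γ, ∀ x ∈ pPlus θ P, ⁅y, x⁆ = 0 := by
    intro γ hγ y hy x hx
    have : pPlus θ P ≤ LinearMap.ker (LieAlgebra.ad ℂ 𝔤 y) := rootSum_le fun δ hδ z hz =>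
      lie_eq_zero_of_add_notMem (h.add_ne_zero hγ.1 hδ.1) (h.add_notMem_roots hγ hδ) hy hz
    exact this hx
  have : pPlus θ P ≤ LinearMap.ker (LieAlgebra.ad ℂ 𝔤 x) := rootSum_le fun δ hδ z hz => by
    change ⁅x, z⁆ = 0
    rw [← lie_skew, h1 δ hδ z hz x hx, neg_zero]
  exact this hy

lemma add_mem_compactRoots (h : IsTotallyPositive θ P) {β γ : Module.Dual ℂ 𝔥}
    (hβ : β ∈ compactRoots θ P) (hγ : γ ∈ compactRoots θ P) (hr : β + γ ∈ P) :
    β + γ ∈ compactRoots θ P :=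
  ⟨hr, rootSpace_add_le (h.positive.subset_roots hβ.1) (h.positive.subset_roots hγ.1)
    (h.positive.subset_roots hr) fun _ hx _ hy => (kk θ).lie_mem (hβ.2 hx) (hγ.2 hy)⟩

/-- A sum of mixed parity is non-compact, and two non-compact positive roots have no root as their
sum. -/
lemma of_add_mem_compactRoots (h : IsTotallyPositive θ P) {β γ : Module.Dual ℂ 𝔥}
    (hβ : β ∈ P) (hγ : γ ∈ P) (hr : β + γ ∈ compactRoots θ P) :
    β ∈ compactRoots θ P ∧ γ ∈ compactRoots θ P := by
  rcases h.compact_or_noncompact hβ with h1 | h1 <;>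
    rcases h.compact_or_noncompact hγ with h2 | h2
  · exact ⟨h1, h2⟩
  · exact (h.not_compact_and_noncompact hr (h.add_mem_noncompactRoots
      (h.positive.subset_roots hβ) h1.2 h2 (h.positive.subset_roots hr.1))).elim
  · rw [add_comm] at hr
    exact (h.not_compact_and_noncompact hr (h.add_mem_noncompactRoots
      (h.positive.subset_roots hγ) h2.2 h1 (h.positive.subset_roots hr.1))).elim
  · exact (h.add_notMem_roots h1 h2 (h.positive.subset_roots hr.1)).elim

/-- A decomposition of a non-compact positive root has one compact and one non-compact term. -/
lemma of_add_mem_noncompactRoots (h : IsTotallyPositive θ P) {β γ : Module.Dual ℂ 𝔥}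
    (hβ : β ∈ P) (hγ : γ ∈ P) (hr : β + γ ∈ noncompactRoots θ P) :
    β ∈ compactRoots θ P ∧ γ ∈ noncompactRoots θ P ∨
      β ∈ noncompactRoots θ P ∧ γ ∈ compactRoots θ P := by
  rcases h.compact_or_noncompact hβ with h1 | h1 <;>
    rcases h.compact_or_noncompact hγ with h2 | h2
  · exact (h.not_compact_and_noncompact (h.add_mem_compactRoots h1 h2 hr.1) hr).elim
  · exact Or.inl ⟨h1, h2⟩
  · exact Or.inr ⟨h1, h2⟩
  · exact (h.add_notMem_roots h1 h2 (h.positive.subset_roots hr.1)).elim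

/-- The positive summands of a compact root are themselves compact, so being indecomposable in P_k
already means being indecomposable in P. -/
lemma simpleRoots_compactRoots (h : IsTotallyPositive θ P) :
    simpleRoots (compactRoots θ P) = simpleRoots P ∩ compactRoots θ P := by
  ext γ
  refine ⟨fun hγ => ⟨⟨hγ.1.1, ?_⟩, hγ.1⟩, fun hγ => ⟨hγ.2, fun a ha b hb => hγ.1.2 a ha.1 b hb.1⟩⟩
  rintro a ha b hb rfl
  obtain ⟨h1, h2⟩ := h.of_add_mem_compactRoots ha hb hγ.1
  exact hγ.2 a h1 b h2 rfl

lemma simpleRoots_eq (h : IsTotallyPositive θ P) :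
    simpleRoots P = simpleRoots (compactRoots θ P) ∪ noncompactSimpleRoots θ P := by
  rw [h.simpleRoots_compactRoots, noncompactSimpleRoots, ← Set.inter_union_distrib_left]
  exact (Set.inter_eq_left.mpr fun γ hγ => h.compact_or_noncompact hγ.1).symm

omit [FiniteDimensional ℂ 𝔤] [LieAlgebra.IsKilling ℂ 𝔤] [𝔥.IsCartanSubalgebra] in
lemma disjoint_simpleRoots (h : IsTotallyPositive θ P) :
    Disjoint (simpleRoots (compactRoots θ P)) (noncompactSimpleRoots θ P) :=
  Set.disjoint_left.mpr fun _ h1 h2 => h.not_compact_and_noncompact h1.1 h2.2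

/-- Both halves go through one induction: a compact root splits into compact ones, and a non-compact
root has exactly one non-compact summand, which carries β along. -/
lemma mem_closure_simpleRoots (h : IsTotallyPositive θ P) :
    ∀ γ ∈ P, (γ ∈ compactRoots θ P →
        γ ∈ AddSubmonoid.closure (simpleRoots (compactRoots θ P))) ∧
      (γ ∈ noncompactRoots θ P → ∃ β ∈ noncompactSimpleRoots θ P,
        ∃ c ∈ AddSubmonoid.closure (simpleRoots (compactRoots θ P)), γ = β + c) := by
  refine h.positive.induction (fun γ hγ => ⟨fun hk => ?_, fun hn => ?_⟩)
    fun β hβ γ hγ hr ihβ ihγ => ⟨fun hk => ?_, fun hn => ?_⟩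
  · refine AddSubmonoid.subset_closure ?_
    rw [h.simpleRoots_compactRoots]
    exact ⟨hγ, hk⟩
  · exact ⟨γ, ⟨hγ, hn⟩, 0, zero_mem _, (add_zero γ).symm⟩
  · obtain ⟨h1, h2⟩ := h.of_add_mem_compactRoots hβ hγ hk
    exact add_mem (ihβ.1 h1) (ihγ.1 h2)
  · rcases h.of_add_mem_noncompactRoots hβ hγ hn with ⟨h1, h2⟩ | ⟨h1, h2⟩
    · obtain ⟨b, hb, c, hc, e⟩ := ihγ.2 h2
      exact ⟨b, hb, β + c, add_mem (ihβ.1 h1) hc, by rw [e]; abel⟩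
    · obtain ⟨b, hb, c, hc, e⟩ := ihβ.2 h1
      exact ⟨b, hb, c + γ, add_mem hc (ihγ.1 h2), by rw [e]; abel⟩

omit [FiniteDimensional ℂ 𝔤] [LieAlgebra.IsKilling ℂ 𝔤] [𝔥.IsCartanSubalgebra] in
lemma closure_le_span (S : Set (Module.Dual ℂ 𝔥)) {c : Module.Dual ℂ 𝔥}
    (hc : c ∈ AddSubmonoid.closure S) : c ∈ Submodule.span ℂ S :=
  (AddSubmonoid.closure_le (S := (Submodule.span ℂ S).toAddSubmonoid)).mpr
    Submodule.subset_span hc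

lemma mem_span_of_compact (h : IsTotallyPositive θ P) {α : Module.Dual ℂ 𝔥} (hα : α ∈ roots 𝔥)
    (hαk : rootSpace 𝔥 α ≤ (kk θ).toSubmodule) :
    α ∈ Submodule.span ℂ (simpleRoots (compactRoots θ P)) := by
  rcases h.positive.mem_or_neg_mem α hα with h1 | h1
  · exact closure_le_span _ ((h.mem_closure_simpleRoots α h1).1 ⟨h1, hαk⟩)
  · have := closure_le_span _ ((h.mem_closure_simpleRoots _ h1).1
      ⟨h1, rootSpace_neg_le_kk h.involutive h.cartan_le hα hαk⟩)
    exact (neg_mem_iff (S := Submodule ℂ (Module.Dual ℂ 𝔥))).mp this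

/-- The non-compact simple roots are distinct modulo the span of the compact roots. -/
lemma eq_of_sub_mem_span (h : IsTotallyPositive θ P) {β β' : Module.Dual ℂ 𝔥}
    (hβ : β ∈ noncompactSimpleRoots θ P) (hβ' : β' ∈ noncompactSimpleRoots θ P)
    (hs : β - β' ∈ Submodule.span ℂ (simpleRoots (compactRoots θ P))) : β = β' := by
  by_contra hne
  have hli := h.positive.linearIndepOn_simpleRoots
  have hβs : β ∈ simpleRoots P := hβ.1
  rw [linearIndepOn_iff_notMem_span] at hli
  refine hli β hβs ?_
  simp only [id, Set.image_id']
  -- If β ≠ β', then β = (β - β') + β' lies in the span of the other simple roots.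
  have hsub : simpleRoots (compactRoots θ P) ⊆ simpleRoots P \ {β} := by
    refine fun γ hγ => ⟨?_, ?_⟩
    · rw [h.simpleRoots_eq]
      exact Or.inl hγ
    · rintro rfl
      exact h.not_compact_and_noncompact hγ.1 hβ.2
  have h2 : β' ∈ Submodule.span ℂ (simpleRoots P \ {β}) :=
    Submodule.subset_span ⟨hβ'.1, fun e => hne e.symm⟩
  have h3 := add_mem (Submodule.span_mono hsub hs) h2
  rwa [sub_add_cancel] at h3

lemma exists_mem_pieceRoots (h : IsTotallyPositive θ P) {γ : Module.Dual ℂ 𝔥}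
    (hγ : γ ∈ noncompactRoots θ P) :
    ∃ β ∈ noncompactSimpleRoots θ P, γ ∈ pieceRoots θ P β := by
  obtain ⟨β, hβ, c, hc, rfl⟩ := (h.mem_closure_simpleRoots γ hγ.1).2 hγ
  exact ⟨β, hβ, hγ, by simpa using closure_le_span _ hc⟩

omit [FiniteDimensional ℂ 𝔤] [LieAlgebra.IsKilling ℂ 𝔤] [𝔥.IsCartanSubalgebra] in
lemma self_mem_pieceRoots {β : Module.Dual ℂ 𝔥} (hβ : β ∈ noncompactSimpleRoots θ P) :
    β ∈ pieceRoots θ P β :=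
  ⟨hβ.2, by simp⟩

lemma eq_of_mem_pieceRoots (h : IsTotallyPositive θ P) {β β' γ : Module.Dual ℂ 𝔥}
    (hβ : β ∈ noncompactSimpleRoots θ P) (hβ' : β' ∈ noncompactSimpleRoots θ P)
    (h1 : γ ∈ pieceRoots θ P β) (h2 : γ ∈ pieceRoots θ P β') : β = β' := by
  refine h.eq_of_sub_mem_span hβ hβ' ?_
  have := sub_mem h2.2 h1.2
  simpa using this

/-- Adding a compact root does not change the class modulo the span of the compact simple roots. -/
lemma lie_mem_piece (h : IsTotallyPositive θ P) (β : Module.Dual ℂ 𝔥) {x y : 𝔤}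
    (hx : x ∈ kk θ) (hy : y ∈ piece θ P β) : ⁅x, y⁆ ∈ piece θ P β := by
  refine lie_mem_rootSum h.cartan_le (fun γ hγ α hα hαk hr => ?_) hx hy
  have h0 : α + γ ≠ 0 := fun h0 => by
    obtain rfl := eq_neg_of_add_eq_zero_left h0
    have := rootSpace_neg_le_kk h.involutive h.cartan_le hα hαk
    rw [neg_neg] at this
    exact not_rootSpace_le_kk_and_pp (h.positive.subset_roots hγ.1.1) this hγ.1.2
  refine ⟨h.add_mem_noncompactRoots hα hαk hγ.1 ⟨h0, hr⟩, ?_⟩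
  rw [add_sub_assoc]
  exact add_mem (h.mem_span_of_compact hα hαk) hγ.2

/-- The sum of the root spaces `𝔤_{-γ}` for `γ ∈ pieceRoots θ P β` is stable under `𝔨`. -/
lemma lie_mem_rootSum_neg_pieceRoots (h : IsTotallyPositive θ P) (β : Module.Dual ℂ 𝔥) {x y : 𝔤}
    (hx : x ∈ kk θ) (hy : y ∈ rootSum {γ | -γ ∈ pieceRoots θ P β}) :
    ⁅x, y⁆ ∈ rootSum {γ | -γ ∈ pieceRoots θ P β} := by
  refine lie_mem_rootSum h.cartan_le (fun γ hγ α hα hαk hr => ?_) hx hy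
  have h0 : α + γ ≠ 0 := fun h0 => by
    have hγ' : -γ ∈ pieceRoots θ P β := hγ
    rw [← eq_neg_of_add_eq_zero_left h0] at hγ'
    exact not_rootSpace_le_kk_and_pp hα hαk hγ'.1.2
  have e : -(α + γ) = -α + -γ := by abel
  refine ⟨?_, ?_⟩
  · rw [e]
    refine h.add_mem_noncompactRoots (neg_mem_roots hα)
      (rootSpace_neg_le_kk h.involutive h.cartan_le hα hαk) hγ.1 ?_
    rw [← e]
    exact neg_mem_roots ⟨h0, hr⟩
  · rw [e, add_sub_assoc]
    exact add_mem (neg_mem (h.mem_span_of_compact hα hαk)) hγ.2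

end IsTotallyPositive

end HarishChandra

/-! ### Irreducibility of the pieces and uniqueness of the decomposition -/

namespace HarishChandra

/-- Moves irreducibility into the lattice of submodules of the ambient module, where complements are
available. -/
lemma isIrreducible_iff_isAtom {R L M : Type*} [CommRing R] [LieRing L] [AddCommGroup M]
    [Module R M] [LieRingModule L M] (m : LieSubmodule R L M) :
    LieModule.IsIrreducible R L m ↔ IsAtom m := by
  have hinj : Function.Injective m.incl := Subtype.coe_injective
  constructor
  · intro hm
    refine ⟨fun h0 => ?_, fun b hb => ?_⟩
    · subst h0
      have := LieModule.nontrivial_of_isIrreducible R L (⊥ : LieSubmodule R L M)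
      exact (LieSubmodule.nontrivial_iff_ne_bot R L M).mp this rfl
    · rcases hm.eq_bot_or_eq_top (b.comap m.incl) with h | h
      · rwa [LieSubmodule.comap_incl_eq_bot, inf_eq_right.mpr hb.le] at h
      · rw [LieSubmodule.comap_incl_eq_top] at h
        exact absurd h (not_le_of_gt hb)
  · intro hm
    have : Nontrivial m := (LieSubmodule.nontrivial_iff_ne_bot R L M).mpr hm.1
    refine LieModule.IsIrreducible.mk fun N hN => ?_
    have h1 : N.map m.incl ≤ m := LieSubmodule.map_incl_le
    rcases hm.le_iff.mp h1 with h | h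
    · refine absurd ((LieSubmodule.eq_bot_iff N).mpr fun x hx => hinj ?_) hN
      have : m.incl x ∈ N.map m.incl := LieSubmodule.mem_map_of_mem hx
      rw [h] at this
      exact this
    · by_contra hne
      exact absurd h (LieSubmodule.map_incl_lt_iff_lt_top.mpr (lt_top_iff_ne_top.mpr hne)).ne

variable {𝔤 : Type*} [LieRing 𝔤] [LieAlgebra ℂ 𝔤] {θ : 𝔤 ≃ₗ⁅ℂ⁆ 𝔤} {𝔥 : LieSubalgebra ℂ 𝔤}
  {P : Set (Module.Dual ℂ 𝔥)}

lemma isIrreducibleSubspace_iff {W : Submodule ℂ 𝔤} : IsIrreducibleSubspace θ W ↔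
    ∃ m : LieSubmodule ℂ (kk θ) 𝔤, m.toSubmodule = W ∧ IsAtom m := by
  simp only [IsIrreducibleSubspace, isIrreducible_iff_isAtom]

lemma IsIrreducibleSubspace.ne_bot {W : Submodule ℂ 𝔤} (h : IsIrreducibleSubspace θ W) :
    W ≠ ⊥ := by
  obtain ⟨m, rfl, hm⟩ := isIrreducibleSubspace_iff.mp h
  exact fun h0 => hm.1 (LieSubmodule.toSubmodule_injective h0)

lemma IsIrreducibleSubspace.eq_of_le {V W : Submodule ℂ 𝔤} (hV : IsIrreducibleSubspace θ V)
    (hW : IsIrreducibleSubspace θ W) (h : V ≤ W) : V = W := by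
  have h0 := hV.ne_bot
  obtain ⟨m, rfl, hm⟩ := isIrreducibleSubspace_iff.mp hV
  obtain ⟨n, rfl, hn⟩ := isIrreducibleSubspace_iff.mp hW
  exact congrArg _ ((hn.le_iff_eq hm.1).mp h)

lemma IsIrreducibleSubspace.le_of_mem {V : Submodule ℂ 𝔤} (hV : IsIrreducibleSubspace θ V)
    {N : Submodule ℂ 𝔤} (hN : ∀ x ∈ kk θ, ∀ y ∈ N, ⁅x, y⁆ ∈ N) {x : 𝔤} (hx : x ∈ V)
    (hxN : x ∈ N) (h0 : x ≠ 0) : V ≤ N := by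
  obtain ⟨m, rfl, hm⟩ := isIrreducibleSubspace_iff.mp hV
  let n : LieSubmodule ℂ (kk θ) 𝔤 := { N with lie_mem := fun {a b} hb => hN a a.2 b hb }
  rcases hm.le_iff.mp (inf_le_left : m ⊓ n ≤ m) with h | h
  · have : x ∈ m ⊓ n := ⟨hx, hxN⟩
    rw [h] at this
    exact absurd this h0
  · exact fun y hy => (inf_eq_left.mp h : m ≤ n) hy

variable [FiniteDimensional ℂ 𝔤] [LieAlgebra.IsKilling ℂ 𝔤] [𝔥.IsCartanSubalgebra]

lemma disjoint_rootSum {Q Q' : Set (Module.Dual ℂ 𝔥)} (h : Disjoint Q Q') :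
    Disjoint (rootSum Q : Submodule ℂ 𝔤) (rootSum Q') :=
  (iSupIndep_rootSpace 𝔥).disjoint_biSup_biSup h

namespace IsTotallyPositive

omit [FiniteDimensional ℂ 𝔤] [LieAlgebra.IsKilling ℂ 𝔤] [𝔥.IsCartanSubalgebra] in
lemma piece_le_pPlus (β : Module.Dual ℂ 𝔥) : piece θ P β ≤ pPlus θ P :=
  rootSum_mono fun _ hγ => hγ.1

lemma pPlus_eq_iSup_piece (h : IsTotallyPositive θ P) :
    pPlus θ P = ⨆ β ∈ noncompactSimpleRoots θ P, piece θ P β := by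
  refine le_antisymm (rootSum_le fun γ hγ => ?_) (iSup₂_le fun β _ => piece_le_pPlus β)
  obtain ⟨β, hβ, hγβ⟩ := h.exists_mem_pieceRoots hγ
  exact (rootSpace_le_rootSum hγβ).trans (le_iSup₂_of_le β hβ le_rfl)

lemma disjoint_piece_iSup (h : IsTotallyPositive θ P) {β : Module.Dual ℂ 𝔥}
    (hβ : β ∈ noncompactSimpleRoots θ P) {T : Set (Module.Dual ℂ 𝔥)}
    (hT : T ⊆ noncompactSimpleRoots θ P) (hβT : β ∉ T) :
    Disjoint (piece θ P β) (⨆ δ ∈ T, piece θ P δ) := by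
  have h1 : ⨆ δ ∈ T, piece θ P δ ≤ rootSum (⋃ δ ∈ T, pieceRoots θ P δ) :=
    iSup₂_le fun δ hδ => rootSum_mono (Set.subset_biUnion_of_mem (u := pieceRoots θ P) hδ)
  refine (disjoint_rootSum (Set.disjoint_left.mpr fun γ hγ hγT => ?_)).mono_right h1
  obtain ⟨δ, hδ, hγδ⟩ := Set.mem_iUnion₂.mp hγT
  exact hβT (h.eq_of_mem_pieceRoots hβ (hT hδ) hγ hγδ ▸ hδ)

lemma iSupIndep_piece (h : IsTotallyPositive θ P) {ι : Type*} {b : ι → Module.Dual ℂ 𝔥}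
    (hb : Function.Injective b) (hbm : ∀ i, b i ∈ noncompactSimpleRoots θ P) :
    iSupIndep fun i => piece θ P (b i) := by
  intro i
  refine (h.disjoint_piece_iSup (hbm i) (T := b '' {j | j ≠ i}) ?_ ?_).mono_right ?_
  · rintro _ ⟨j, -, rfl⟩
    exact hbm j
  · rintro ⟨j, hj, e⟩
    exact hj (hb e)
  · exact iSup₂_le fun j hj => le_iSup₂_of_le (b j) ⟨j, hj, rfl⟩ le_rfl

/-- A nonzero `𝔨`-stable subspace of `𝔭⁺` contains the root space of a non-compact simple root. -/
lemma exists_rootSpace_le (h : IsTotallyPositive θ P) {N : Submodule ℂ 𝔤}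
    (hN : ∀ x ∈ kk θ, ∀ y ∈ N, ⁅x, y⁆ ∈ N) (hle : N ≤ pPlus θ P) (h0 : N ≠ ⊥) :
    ∃ β ∈ noncompactSimpleRoots θ P, rootSpace 𝔥 β ≤ N := by
  obtain ⟨γ, hγ⟩ : ∃ γ, N ⊓ rootSpace 𝔥 γ ≠ ⊥ := by
    by_contra! hcon
    refine h0 ?_
    rw [eq_iSup_inf_rootSpace (𝔥 := 𝔥) N fun H hH x hx => hN H (h.cartan_le hH) x hx]
    simp [hcon]
  have hγn : γ ∈ noncompactRoots θ P := by
    refine mem_of_rootSpace_inf_rootSum_ne_bot fun hb => hγ ?_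
    exact le_bot_iff.mp ((inf_le_inf_right _ hle).trans hb.le)
  -- N contains a full root space 𝔤_γ. While γ is not simple, one of its two summands is compact;
  -- subtracting it stays inside N and leads to a smaller non-compact root.
  have hγN := (inf_eq_bot_or_rootSpace_le (h.positive.subset_roots hγn.1) N).resolve_left hγ
  revert hγn hγN
  refine fun hγn => h.positive.induction
    (p := fun γ => γ ∈ noncompactRoots θ P → rootSpace 𝔥 γ ≤ N →
      ∃ β ∈ noncompactSimpleRoots θ P, rootSpace 𝔥 β ≤ N)
    (fun γ hγ hγn hγN => ⟨γ, ⟨hγ, hγn⟩, hγN⟩) (fun a ha b hb hab iha ihb hn hle => ?_)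
    γ hγn.1 hγn
  have hr := h.positive.subset_roots hab
  rcases h.of_add_mem_noncompactRoots ha hb hn with ⟨h1, h2⟩ | ⟨h1, h2⟩
  · refine ihb h2 ?_
    obtain ⟨h3, h4⟩ := h.neg_compact h1
    have e : -a + (a + b) = b := by abel
    have := rootSpace_add_le (N := N) h3 hr (by rw [e]; exact h.positive.subset_roots hb)
      fun x hx y hy => hN x (h4 hx) y (hle hy)
    rwa [e] at this
  · refine iha h1 ?_
    obtain ⟨h3, h4⟩ := h.neg_compact h2
    have e : -b + (a + b) = a := by abel
    have := rootSpace_add_le (N := N) h3 hr (by rw [e]; exact h.positive.subset_roots ha)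
      fun x hx y hy => hN x (h4 hx) y (hle hy)
    rwa [e] at this

lemma rootSpace_le_piece_iff {β γ : Module.Dual ℂ 𝔥} (hγ : γ ∈ roots 𝔥) :
    rootSpace 𝔥 γ ≤ piece θ P β ↔ γ ∈ pieceRoots θ P β :=
  ⟨mem_of_rootSpace_le_rootSum hγ, rootSpace_le_rootSum⟩

omit [FiniteDimensional ℂ 𝔤] [LieAlgebra.IsKilling ℂ 𝔤] [𝔥.IsCartanSubalgebra] in
lemma mem_roots_of_simple (h : IsTotallyPositive θ P) {β : Module.Dual ℂ 𝔥}
    (hβ : β ∈ noncompactSimpleRoots θ P) : β ∈ roots 𝔥 :=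
  h.positive.subset_roots hβ.2.1

/-- The non-compact simple root found in N belongs to the piece of β, and a piece contains only one
such root. -/
lemma rootSpace_le_of_le_piece (h : IsTotallyPositive θ P) {β : Module.Dual ℂ 𝔥}
    (hβ : β ∈ noncompactSimpleRoots θ P) {N : Submodule ℂ 𝔤}
    (hN : ∀ x ∈ kk θ, ∀ y ∈ N, ⁅x, y⁆ ∈ N) (hle : N ≤ piece θ P β) (h0 : N ≠ ⊥) :
    rootSpace 𝔥 β ≤ N := by
  obtain ⟨β', hβ', hle'⟩ := h.exists_rootSpace_le hN (hle.trans (piece_le_pPlus β)) h0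
  have := (rootSpace_le_piece_iff (h.mem_roots_of_simple hβ')).mp (hle'.trans hle)
  rwa [h.eq_of_mem_pieceRoots hβ hβ' this (self_mem_pieceRoots hβ')]

/-- Every nonzero submodule contains 𝔤_β, so a proper nonzero one and a complement of it inside the
piece would both contain it. -/
lemma isIrreducibleSubspace_piece (h : IsTotallyPositive θ P)
    [ComplementedLattice (LieSubmodule ℂ (kk θ) 𝔤)] {β : Module.Dual ℂ 𝔥}
    (hβ : β ∈ noncompactSimpleRoots θ P) : IsIrreducibleSubspace θ (piece θ P β) := by
  let m : LieSubmodule ℂ (kk θ) 𝔤 :=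
    { piece θ P β with lie_mem := fun {x y} hy => h.lie_mem_piece β x.2 hy }
  have hβm : rootSpace 𝔥 β ≤ m.toSubmodule := rootSpace_le_rootSum (self_mem_pieceRoots hβ)
  have hR : ∀ n : LieSubmodule ℂ (kk θ) 𝔤, n ≤ m → n ≠ ⊥ → rootSpace 𝔥 β ≤ n.toSubmodule := by
    intro n hn h0
    refine h.rootSpace_le_of_le_piece hβ (fun x hx y hy => n.lie_mem (x := ⟨x, hx⟩) hy) hn
      fun hb => h0 (LieSubmodule.toSubmodule_injective hb)
  obtain ⟨x, hx, hx0⟩ := exists_ne_zero_of_mem_roots (h.mem_roots_of_simple hβ)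
  refine isIrreducibleSubspace_iff.mpr ⟨m, rfl, fun h0 => ?_, fun n hn => ?_⟩
  · have : x ∈ m := hβm hx
    rw [h0] at this
    exact hx0 this
  · by_contra hn0
    obtain ⟨c, hc⟩ := exists_isCompl n
    have h1 := hR n hn.le hn0
    -- The modular law cuts the complement taken in 𝔤 down to one in the piece.
    have hsup : n ⊔ c ⊓ m = m := by
      rw [← sup_inf_assoc_of_le c hn.le, hc.sup_eq_top, top_inf_eq]
    have hc0 : c ⊓ m ≠ ⊥ := fun h0 => by
      rw [h0, sup_bot_eq] at hsup
      exact hn.ne hsup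
    have h2 := hR (c ⊓ m) inf_le_right hc0
    have : x ∈ n ⊓ c := ⟨h1 hx, (h2 hx).1⟩
    rw [hc.inf_eq_bot] at this
    exact hx0 this

/-- An irreducible V contains some 𝔤_β, hence meets the irreducible piece of β and equals it. This
is what makes the decomposition unique. -/
lemma isIrreducibleSubspace_iff_piece (h : IsTotallyPositive θ P)
    [ComplementedLattice (LieSubmodule ℂ (kk θ) 𝔤)] {V : Submodule ℂ 𝔤} :
    IsIrreducibleSubspace θ V ∧ V ≤ pPlus θ P ↔
      ∃ β ∈ noncompactSimpleRoots θ P, V = piece θ P β := by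
  constructor
  · rintro ⟨hV, hle⟩
    have hst : ∀ x ∈ kk θ, ∀ y ∈ V, ⁅x, y⁆ ∈ V := by
      obtain ⟨m, rfl, -⟩ := hV
      exact fun x hx y hy => m.lie_mem (x := ⟨x, hx⟩) hy
    obtain ⟨β, hβ, hβV⟩ := h.exists_rootSpace_le hst hle hV.ne_bot
    obtain ⟨x, hx, hx0⟩ := exists_ne_zero_of_mem_roots (h.mem_roots_of_simple hβ)
    exact ⟨β, hβ, hV.eq_of_le (h.isIrreducibleSubspace_piece hβ)
      (hV.le_of_mem (fun x hx y hy => h.lie_mem_piece β hx hy) (hβV hx)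
        (rootSpace_le_rootSum (self_mem_pieceRoots hβ) hx) hx0)⟩
  · rintro ⟨β, hβ, rfl⟩
    exact ⟨h.isIrreducibleSubspace_piece hβ, piece_le_pPlus β⟩

/-- The unique lowest root of `piece θ P β` is `β`. -/
lemma isLowestRoot_piece_iff (h : IsTotallyPositive θ P) {β γ : Module.Dual ℂ 𝔥}
    (hβ : β ∈ noncompactSimpleRoots θ P) : IsLowestRoot θ P (piece θ P β) γ ↔ γ = β := by
  constructor
  · intro hγ
    have hγβ := (rootSpace_le_piece_iff hγ.mem_roots).mp hγ.rootSpace_le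
    -- Were γ = a + b with a compact, 𝔤_{-a} would move 𝔤_γ nontrivially into 𝔤_b. So a lowest root
    -- is indecomposable.
    have hkey : ∀ a b, a ∈ compactRoots θ P → b ∈ noncompactRoots θ P → γ ≠ a + b := by
      rintro a b ha hb rfl
      have e : -a + (a + b) = b := by abel
      have hbr := h.positive.subset_roots hb.1
      obtain ⟨x, hx, y, hy, h0⟩ :=
        exists_lie_ne_zero (h.neg_compact ha).1 hγ.mem_roots (by rwa [e])
      exact h0 (hγ.lie_eq_zero a ha x hx y hy)
    have hγs : γ ∈ noncompactSimpleRoots θ P := by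
      refine ⟨⟨hγβ.1.1, fun a ha b hb e => ?_⟩, hγβ.1⟩
      rcases h.of_add_mem_noncompactRoots ha hb (e ▸ hγβ.1) with ⟨h1, h2⟩ | ⟨h1, h2⟩
      · exact hkey a b h1 h2 e
      · exact hkey b a h2 h1 (by rw [e, add_comm])
    exact (h.eq_of_mem_pieceRoots hβ hγs hγβ (self_mem_pieceRoots hγs)).symm
  · rintro rfl
    refine ⟨h.mem_roots_of_simple hβ, rootSpace_le_rootSum (self_mem_pieceRoots hβ),
      fun a ha x hx y hy => ?_⟩
    have hne : -a + γ ≠ 0 := fun h0 => by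
      have : γ = a := by rw [← sub_eq_zero, sub_eq_neg_add, h0]
      subst this
      exact h.not_compact_and_noncompact ha hβ.2
    refine lie_eq_zero_of_add_notMem hne (fun hr => ?_) hx hy
    obtain ⟨h1, h2⟩ := h.neg_compact ha
    have := h.add_mem_noncompactRoots h1 h2 hβ.2 hr
    exact hβ.1.2 a ha.1 (-a + γ) this.1 (by abel)

/-- A decomposition of `𝔭⁺` consists of the subspaces `piece θ P β`. -/
lemma exists_piece_eq_of_isDecomposition (h : IsTotallyPositive θ P)
    [ComplementedLattice (LieSubmodule ℂ (kk θ) 𝔤)] {s : ℕ} {W : Fin s → Submodule ℂ 𝔤}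
    (hW : IsDecomposition θ P W) :
    ∃ b : Fin s → Module.Dual ℂ 𝔥, Function.Injective b ∧
      Set.range b = noncompactSimpleRoots θ P ∧ ∀ i, W i = piece θ P (b i) := by
  have h1 : ∀ i, ∃ β ∈ noncompactSimpleRoots θ P, W i = piece θ P β := fun i =>
    h.isIrreducibleSubspace_iff_piece.mp ⟨hW.irreducible i, hW.sum_eq ▸ le_iSup W i⟩
  choose b hb hWb using h1
  refine ⟨b, fun i j hij => ?_, ?_, hWb⟩
  · refine hW.independent.injective (fun i => (hW.irreducible i).ne_bot) ?_
    rw [hWb, hWb, hij]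
  · refine Set.Subset.antisymm (by rintro _ ⟨i, rfl⟩; exact hb i) fun β hβ => ?_
    -- A piece missing from the family would be disjoint from its sum, which is all of 𝔭⁺.
    by_contra hn
    have hd := h.disjoint_piece_iSup hβ (T := Set.range b) (by rintro _ ⟨i, rfl⟩; exact hb i) hn
    have hle : piece θ P β ≤ ⨆ δ ∈ Set.range b, piece θ P δ := by
      refine (piece_le_pPlus β).trans ?_
      rw [← hW.sum_eq]
      exact iSup_le fun i => hWb i ▸ le_iSup₂_of_le (b i) ⟨i, rfl⟩ le_rfl
    exact (h.isIrreducibleSubspace_piece hβ).ne_bot (hd.eq_bot_of_le hle)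

lemma finite_noncompactSimpleRoots (h : IsTotallyPositive θ P) :
    (noncompactSimpleRoots θ P).Finite :=
  h.positive.finite.subset fun _ hγ => hγ.1.1

lemma exists_isDecomposition (h : IsTotallyPositive θ P)
    [ComplementedLattice (LieSubmodule ℂ (kk θ) 𝔤)] :
    ∃ (s : ℕ) (W : Fin s → Submodule ℂ 𝔤) (β : Fin s → Module.Dual ℂ 𝔥),
      IsDecomposition θ P W ∧ ∀ i, IsLowestRoot θ P (W i) (β i) := by
  have := h.finite_noncompactSimpleRoots.fintype
  let e := (Fintype.equivFin (noncompactSimpleRoots θ P)).symm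
  have he : ∀ i, (e i : Module.Dual ℂ 𝔥) ∈ noncompactSimpleRoots θ P := fun i => (e i).2
  refine ⟨_, fun i => piece θ P (e i : Module.Dual ℂ 𝔥), fun i => e i, ⟨fun i =>
    h.isIrreducibleSubspace_piece (he i), h.iSupIndep_piece
    (Subtype.val_injective.comp e.injective) he, ?_⟩,
    fun i => (h.isLowestRoot_piece_iff (he i)).mpr rfl⟩
  rw [h.pPlus_eq_iSup_piece, iSup_subtype']
  exact e.iSup_comp (g := fun β : noncompactSimpleRoots θ P => piece θ P (β : Module.Dual ℂ 𝔥))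

end IsTotallyPositive

end HarishChandra

/-! ### The centre of 𝔨, dimension counts and uniqueness of coefficients -/

namespace HarishChandra

variable {𝔤 : Type*} [LieRing 𝔤] [LieAlgebra ℂ 𝔤] {θ : 𝔤 ≃ₗ⁅ℂ⁆ 𝔤} {𝔥 : LieSubalgebra ℂ 𝔤}
  {P : Set (Module.Dual ℂ 𝔥)}

lemma mem_centre {x : 𝔤} : x ∈ centre θ ↔ x ∈ kk θ ∧ ∀ y ∈ kk θ, ⁅y, x⁆ = 0 := by
  constructor
  · rintro ⟨z, hz, rfl⟩
    refine ⟨z.2, fun y hy => ?_⟩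
    have := (LieModule.mem_maxTrivSubmodule ℂ (kk θ) (kk θ) z).mp hz ⟨y, hy⟩
    exact congrArg Subtype.val this
  · rintro ⟨hx, h⟩
    refine ⟨⟨x, hx⟩,
      (LieModule.mem_maxTrivSubmodule ℂ (kk θ) (kk θ) _).mpr fun y => Subtype.ext ?_, rfl⟩
    exact h y y.2

namespace IsTotallyPositive

variable [FiniteDimensional ℂ 𝔤] [LieAlgebra.IsKilling ℂ 𝔤] [𝔥.IsCartanSubalgebra]

lemma centre_le_cartan (h : IsTotallyPositive θ P) : centre θ ≤ 𝔥.toSubmodule := fun _ hx =>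
  mem_cartan_of_lie_eq_zero fun y hy => (mem_centre.mp hx).2 y (h.cartan_le hy)

/-- An element H of 𝔥 acts on each compact root space by the value of the root, and 𝔨 is spanned by
𝔥 and these spaces. So H is central exactly when all compact roots, equivalently the simple ones,
vanish on it. -/
lemma centre_comap_eq (h : IsTotallyPositive θ P) :
    (centre θ).comap 𝔥.toSubmodule.subtype =
      (Submodule.span ℂ (simpleRoots (compactRoots θ P))).dualCoannihilator := by
  ext H
  rw [Submodule.mem_dualCoannihilator]
  constructor
  · intro hH φ hφ
    have hc := (mem_centre.mp hH).2
    induction hφ using Submodule.span_induction with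
    | mem φ hφ =>
      obtain ⟨x, hx, h0⟩ := exists_ne_zero_of_mem_roots (h.positive.subset_roots hφ.1.1)
      have h1 := mem_rootSpace.mp hx H
      rw [← lie_skew] at h1
      have h2 := hc x (hφ.1.2 hx)
      change ⁅x, (H : 𝔤)⁆ = 0 at h2
      rw [h2, neg_zero] at h1
      exact (smul_eq_zero.mp h1.symm).resolve_right h0
    | zero => rfl
    | add a b _ _ ha hb => rw [LinearMap.add_apply, ha, hb, add_zero]
    | smul c a _ ha => rw [LinearMap.smul_apply, ha, smul_zero]
  · intro hH
    refine mem_centre.mpr ⟨h.cartan_le H.2, ?_⟩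
    have := kk_le (N := LinearMap.ker (LieAlgebra.ad ℂ 𝔤 (H : 𝔤))) h.cartan_le
      (fun x hx => lie_cartan_eq_zero H.2 hx) (fun α hα hαk x hx => ?_)
    · intro y hy
      have h1 : ⁅(H : 𝔤), y⁆ = 0 := this hy
      change ⁅y, (H : 𝔤)⁆ = 0
      rw [← lie_skew, h1, neg_zero]
    · change ⁅(H : 𝔤), x⁆ = 0
      rw [mem_rootSpace.mp hx H, hH α (h.mem_span_of_compact hα hαk), zero_smul]

lemma ncard_add_ncard (h : IsTotallyPositive θ P) :
    (simpleRoots (compactRoots θ P)).ncard + (noncompactSimpleRoots θ P).ncard =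
      Module.finrank ℂ 𝔥 := by
  rw [← h.positive.ncard_simpleRoots, h.simpleRoots_eq, Set.ncard_union_eq h.disjoint_simpleRoots
    (h.positive.finite.subset fun _ hγ => hγ.1.1) h.finite_noncompactSimpleRoots]

lemma linearIndepOn_simpleRoots_compactRoots (h : IsTotallyPositive θ P) :
    LinearIndepOn ℂ id (simpleRoots (compactRoots θ P)) :=
  h.positive.linearIndepOn_simpleRoots.mono (h.simpleRoots_eq ▸ Set.subset_union_left)

/-- The centre is the common kernel in 𝔥 of the independent compact simple roots; its dimension is
therefore the number of the remaining simple roots. -/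
lemma finrank_center (h : IsTotallyPositive θ P) :
    Module.finrank ℂ (LieAlgebra.center ℂ (kk θ)) = (noncompactSimpleRoots θ P).ncard := by
  have h1 : Module.finrank ℂ (LieAlgebra.center ℂ (kk θ)) = Module.finrank ℂ (centre θ) :=
    LinearEquiv.finrank_eq (Submodule.equivMapOfInjective _ (Submodule.injective_subtype _)
      (LieAlgebra.center ℂ (kk θ)).toSubmodule)
  have h2 : Module.finrank ℂ (centre θ) =
      Module.finrank ℂ ((centre θ).comap 𝔥.toSubmodule.subtype) :=
    (LinearEquiv.finrank_eq (Submodule.comapSubtypeEquivOfLe h.centre_le_cartan)).symm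
  have h3 := Subspace.finrank_add_finrank_dualCoannihilator_eq
    (Submodule.span ℂ (simpleRoots (compactRoots θ P)))
  have h4 : Module.finrank ℂ (Submodule.span ℂ (simpleRoots (compactRoots θ P))) =
      (simpleRoots (compactRoots θ P)).ncard := by
    have hfin : (simpleRoots (compactRoots θ P)).Finite :=
      h.positive.finite.subset fun _ hγ => hγ.1.1
    have := hfin.fintype
    have hb := finrank_span_set_eq_card h.linearIndepOn_simpleRoots_compactRoots
    rw [hb, Set.ncard_eq_toFinset_card']
  have h5 := h.ncard_add_ncard
  rw [← h.centre_comap_eq, h4, ← h5] at h3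
  rw [h1, h2]
  exact Nat.add_left_cancel h3

/-- By double annihilation the kernel of restriction to the centre is the span of the compact simple
roots, which meets the span of the non-compact ones trivially. -/
lemma linearIndependent_restrictToCentre (h : IsTotallyPositive θ P) {ι : Type*}
    {b : ι → Module.Dual ℂ 𝔥} (hb : Function.Injective b)
    (hbm : ∀ i, b i ∈ noncompactSimpleRoots θ P) :
    LinearIndependent ℂ fun i => restrictToCentre θ (b i) := by
  have hli := h.positive.linearIndepOn_simpleRoots
  have h1 : LinearIndependent ℂ b := by
    have h2 : LinearIndepOn ℂ id (Set.range b) := hli.mono (by rintro _ ⟨i, rfl⟩; exact (hbm i).1)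
    exact (linearIndepOn_id_range_iff hb).mp h2
  refine h1.map (f := ((centre θ).comap 𝔥.toSubmodule.subtype).dualRestrict) ?_
  rw [Submodule.dualRestrict_ker_eq_dualAnnihilator, h.centre_comap_eq,
    Subspace.dualCoannihilator_dualAnnihilator_eq]
  have h3 : LinearIndependent ℂ (fun γ : simpleRoots P => (γ : Module.Dual ℂ 𝔥)) := hli
  have h4 := h3.disjoint_span_image (s := {γ | (γ : Module.Dual ℂ 𝔥) ∈ noncompactSimpleRoots θ P})
    (t := {γ | (γ : Module.Dual ℂ 𝔥) ∈ simpleRoots (compactRoots θ P)})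
    (Set.disjoint_left.mpr fun γ hγ hγ' => Set.disjoint_left.mp h.disjoint_simpleRoots hγ' hγ)
  refine h4.mono (Submodule.span_mono ?_) (Submodule.span_mono ?_)
  · rintro _ ⟨i, rfl⟩
    exact ⟨⟨b i, (hbm i).1⟩, hbm i, rfl⟩
  · intro γ hγ
    exact ⟨⟨γ, h.simpleRoots_eq ▸ Or.inl hγ⟩, hγ, rfl⟩

/-- Each non-compact positive root is uniquely a non-compact simple root plus a combination of
compact simple roots. -/
lemma existsUnique_eq_add_sum (h : IsTotallyPositive θ P) {r s : ℕ}
    {α : Fin r → Module.Dual ℂ 𝔥} (hα : Function.Injective α)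
    (hα_range : Set.range α = simpleRoots (compactRoots θ P)) {b : Fin s → Module.Dual ℂ 𝔥}
    (hb : Function.Injective b) (hb_range : Set.range b = noncompactSimpleRoots θ P)
    {γ : Module.Dual ℂ 𝔥} (hγ : γ ∈ noncompactRoots θ P) :
    ∃! im : Fin s × (Fin r → ℕ), γ = b im.1 + ∑ j, im.2 j • α j := by
  obtain ⟨β, hβ, c, hc, rfl⟩ := (h.mem_closure_simpleRoots γ hγ.1).2 hγ
  obtain ⟨i, rfl⟩ : ∃ i, b i = β := by rwa [← hb_range] at hβ
  have hsum : ∃ m : Fin r → ℕ, c = ∑ j, m j • α j := by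
    rw [← hα_range] at hc
    exact (AddSubmonoid.mem_closure_range_iff_of_fintype).mp hc |>.imp fun _ h => by rw [h]
  obtain ⟨m, rfl⟩ := hsum
  have hαli : LinearIndependent ℂ α := by
    have := h.linearIndepOn_simpleRoots_compactRoots
    rw [← hα_range] at this
    exact (linearIndepOn_id_range_iff hα).mp this
  refine ⟨(i, m), rfl, ?_⟩
  rintro ⟨i', m'⟩ e
  simp only at e
  have hspan : ∀ n : Fin r → ℕ, ∑ j, n j • α j ∈
      Submodule.span ℂ (simpleRoots (compactRoots θ P)) := fun n =>
    sum_mem fun j _ => nsmul_mem (Submodule.subset_span (hα_range ▸ ⟨j, rfl⟩)) _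
  -- Non-compact simple roots are distinct modulo compact combinations, so the index is forced
  -- first; independence then fixes the coefficients.
  have hi : i' = i := by
    refine hb (h.eq_of_sub_mem_span (hb_range ▸ ⟨i', rfl⟩) (hb_range ▸ ⟨i, rfl⟩) ?_)
    have : b i' - b i = ∑ j, m j • α j - ∑ j, m' j • α j := by
      rw [sub_eq_sub_iff_add_eq_add, ← e, add_comm]
    rw [this]
    exact sub_mem (hspan m) (hspan m')
  subst hi
  have e2 := add_left_cancel e
  have : (fun j => (m j : ℂ)) = fun j => (m' j : ℂ) := by
    refine linearIndependent_iff_injective_fintypeLinearCombination.mp hαli ?_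
    simpa [Fintype.linearCombination_apply, Nat.cast_smul_eq_nsmul] using e2
  rw [Prod.mk.injEq]
  exact ⟨rfl, funext fun j => by exact_mod_cast (congrFun this j).symm⟩

end IsTotallyPositive

end HarishChandra

/-! ### Restriction of the structure to a θ-stable ideal with a complementary ideal -/

namespace HarishChandra

lemma eq_zero_of_forall_lie {𝔤 : Type*} [LieRing 𝔤] [LieAlgebra ℂ 𝔤] [FiniteDimensional ℂ 𝔤]
    [LieAlgebra.IsKilling ℂ 𝔤] {x : 𝔤} (h : ∀ y : 𝔤, ⁅y, x⁆ = 0) : x = 0 := by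
  have : x ∈ LieAlgebra.center ℂ 𝔤 := (LieModule.mem_maxTrivSubmodule ℂ 𝔤 𝔤 x).mpr h
  rwa [LieAlgebra.center_eq_bot, LieSubmodule.mem_bot] at this

section Ideals

variable {𝔤 : Type*} [LieRing 𝔤] [LieAlgebra ℂ 𝔤] {I C : LieIdeal ℂ 𝔤}

lemma lie_eq_zero_of_isCompl (hIC : IsCompl I C) {x y : 𝔤} (hx : x ∈ I) (hy : y ∈ C) :
    ⁅x, y⁆ = 0 := by
  have : ⁅x, y⁆ ∈ I ⊓ C := ⟨lie_mem_left ℂ 𝔤 I x y hx, lie_mem_right ℂ 𝔤 C x y hy⟩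
  rwa [hIC.inf_eq_bot] at this

lemma exists_add_of_isCompl (hIC : IsCompl I C) (x : 𝔤) : ∃ y ∈ I, ∃ z ∈ C, y + z = x := by
  have : x ∈ I ⊔ C := by rw [hIC.sup_eq_top]; trivial
  exact (LieSubmodule.mem_sup _ _ _).mp this

variable {θ : 𝔤 ≃ₗ⁅ℂ⁆ 𝔤}

/-- The restriction of an involution to a stable ideal. -/
def restrictInvolution (θ : 𝔤 ≃ₗ⁅ℂ⁆ 𝔤) (hinv : ∀ x, θ (θ x) = x) (I : LieIdeal ℂ 𝔤)
    (hθI : ∀ x ∈ I, θ x ∈ I) : I ≃ₗ⁅ℂ⁆ I where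
  toFun x := ⟨θ x, hθI x x.2⟩
  invFun x := ⟨θ x, hθI x x.2⟩
  map_add' x y := Subtype.ext (map_add θ (x : 𝔤) y)
  map_smul' c x := Subtype.ext (map_smul θ c (x : 𝔤))
  map_lie' {x y} := Subtype.ext (LieEquiv.map_lie θ (x : 𝔤) y)
  left_inv x := Subtype.ext (hinv x)
  right_inv x := Subtype.ext (hinv x)

variable (hinv : ∀ x, θ (θ x) = x) (hθI : ∀ x ∈ I, θ x ∈ I)

lemma mem_kk_restrictInvolution {x : I} :
    x ∈ kk (restrictInvolution θ hinv I hθI) ↔ (x : 𝔤) ∈ kk θ :=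
  Subtype.ext_iff

lemma mem_pp_restrictInvolution {x : I} :
    x ∈ pp (restrictInvolution θ hinv I hθI) ↔ (x : 𝔤) ∈ pp θ :=
  Subtype.ext_iff

variable [FiniteDimensional ℂ 𝔤] [LieAlgebra.IsKilling ℂ 𝔤]

include hinv hθI in
/-- The component in a `θ`-stable ideal of an element of `𝔨` lies in `𝔨`. -/
lemma exists_kk_component (hIC : IsCompl I C) {x : 𝔤} (hx : x ∈ kk θ) :
    ∃ y ∈ I, y ∈ kk θ ∧ x - y ∈ C := by
  obtain ⟨y, hy, z, hz, rfl⟩ := exists_add_of_isCompl hIC x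
  refine ⟨y, hy, ?_, by simpa using hz⟩
  rw [mem_kk] at *
  rw [← sub_eq_zero]
  have hyI : θ y - y ∈ I := sub_mem (hθI y hy) hy
  have e : θ y - y = z - θ z := by
    rw [map_add] at hx
    rw [sub_eq_sub_iff_add_eq_add, hx, add_comm]
  -- The complement C is not assumed θ-stable, so θy - y is shown to be central instead. It lies in
  -- I, hence commutes with C; it equals z - θz, and [v, θz] = θ[θv, z] = 0 for v in I.
  refine eq_zero_of_forall_lie fun u => ?_
  obtain ⟨v, hv, w, hw, rfl⟩ := exists_add_of_isCompl hIC u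
  have hw0 : ⁅w, θ y - y⁆ = 0 := by
    rw [← lie_skew, lie_eq_zero_of_isCompl hIC hyI hw, neg_zero]
  have hv0 : ⁅v, θ y - y⁆ = 0 := by
    rw [e, lie_sub, lie_eq_zero_of_isCompl hIC hv hz, zero_sub]
    have : ⁅v, θ z⁆ = θ ⁅θ v, z⁆ := by rw [LieEquiv.map_lie, hinv]
    rw [this, lie_eq_zero_of_isCompl hIC (hθI v hv) hz, map_zero, neg_zero]
  rw [add_lie, hv0, hw0, add_zero]

/-- The C-component of an element of 𝔨 kills I, so a submodule of I for 𝔨 ∩ I is already a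
𝔨-submodule of 𝔤. A complement in 𝔤, intersected with I, is a complement in I. -/
lemma complementedLattice_restrictInvolution (hIC : IsCompl I C)
    [ComplementedLattice (LieSubmodule ℂ (kk θ) 𝔤)] :
    ComplementedLattice
      (LieSubmodule ℂ (kk (restrictInvolution θ hinv I hθI)) I) := by
  refine ⟨fun N => ?_⟩
  let N' : LieSubmodule ℂ (kk θ) 𝔤 :=
    { carrier := {x | ∃ n ∈ N, (n : 𝔤) = x}
      add_mem' := by
        rintro _ _ ⟨a, ha, rfl⟩ ⟨b, hb, rfl⟩
        exact ⟨a + b, add_mem ha hb, rfl⟩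
      zero_mem' := ⟨0, zero_mem _, rfl⟩
      smul_mem' := by
        rintro c _ ⟨a, ha, rfl⟩
        exact ⟨c • a, N.smul_mem c ha, rfl⟩
      lie_mem := by
        rintro x _ ⟨n, hn, rfl⟩
        obtain ⟨y, hy, hyk, hxy⟩ := exists_kk_component hinv hθI hIC x.2
        refine ⟨⁅(⟨y, hy⟩ : I), n⁆, N.lie_mem (x := ⟨⟨y, hy⟩, Subtype.ext hyk⟩) hn, ?_⟩
        change ⁅y, (n : 𝔤)⁆ = ⁅(x : 𝔤), (n : 𝔤)⁆
        rw [← sub_eq_zero, ← sub_lie, ← neg_sub, neg_lie, ← lie_skew,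
          lie_eq_zero_of_isCompl hIC n.2 hxy, neg_zero, neg_zero] }
  obtain ⟨c, hc⟩ := exists_isCompl N'
  let c' : LieSubmodule ℂ (kk (restrictInvolution θ hinv I hθI)) I :=
    { c.toSubmodule.comap I.toSubmodule.subtype with
      lie_mem := fun {x m} hm => c.lie_mem (x := ⟨((x : I) : 𝔤),
        (mem_kk_restrictInvolution hinv hθI).mp x.2⟩) (m := (m : 𝔤)) hm }
  refine ⟨c', ?_, ?_⟩
  · rw [disjoint_iff, LieSubmodule.eq_bot_iff]
    rintro x ⟨hx, hxc⟩
    have : (x : 𝔤) ∈ N' ⊓ c := ⟨⟨x, hx, rfl⟩, hxc⟩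
    rw [hc.inf_eq_bot] at this
    exact Subtype.ext this
  · rw [codisjoint_iff, eq_top_iff]
    intro x _
    have hx : (x : 𝔤) ∈ N' ⊔ c := by rw [hc.sup_eq_top]; trivial
    obtain ⟨_, ⟨n, hn, rfl⟩, w, hw, e⟩ := (LieSubmodule.mem_sup _ _ _).mp hx
    refine (LieSubmodule.mem_sup _ _ _).mpr ⟨n, hn, x - n, ?_, add_sub_cancel n x⟩
    change (x : 𝔤) - n ∈ c
    rwa [← e, add_sub_cancel_left]

variable {𝔥 : LieSubalgebra ℂ 𝔤} [𝔥.IsCartanSubalgebra]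

/-- A Cartan subalgebra is the sum of its intersections with complementary ideals. -/
lemma cartan_component_mem (hIC : IsCompl I C) {y z : 𝔤} (hy : y ∈ I) (hz : z ∈ C)
    (h : y + z ∈ 𝔥) : y ∈ 𝔥 := by
  refine mem_cartan_of_lie_eq_zero fun H hH => ?_
  have h0 := lie_cartan_eq_zero hH h
  have hyz : ⁅H, y⁆ ∈ I ⊓ C := by
    refine ⟨lie_mem_right ℂ 𝔤 I H y hy, ?_⟩
    rw [lie_add] at h0
    rw [eq_neg_of_add_eq_zero_left h0]
    exact neg_mem (lie_mem_right ℂ 𝔤 C H z hz)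
  rwa [hIC.inf_eq_bot] at hyz

/-- The C-component of 𝔥 commutes with I, so an element of I normalizing 𝔥 ∩ I normalizes 𝔥. -/
lemma isCartanSubalgebra_idealCartan (hIC : IsCompl I C) :
    (idealCartan 𝔥 I).IsCartanSubalgebra := by
  have hab : IsLieAbelian (idealCartan 𝔥 I) :=
    ⟨fun x y => Subtype.ext (Subtype.ext (lie_cartan_eq_zero x.2 y.2))⟩
  refine ⟨inferInstance, le_antisymm (fun x hx => ?_) (LieSubalgebra.le_normalizer _)⟩
  rw [LieSubalgebra.mem_normalizer_iff'] at hx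
  change (x : 𝔤) ∈ 𝔥
  rw [← LieSubalgebra.IsCartanSubalgebra.self_normalizing (H := 𝔥),
    LieSubalgebra.mem_normalizer_iff']
  intro H hH
  obtain ⟨y, hy, z, hz, rfl⟩ := exists_add_of_isCompl hIC H
  have h1 : ⁅y, (x : 𝔤)⁆ ∈ 𝔥 := hx ⟨y, hy⟩ (cartan_component_mem hIC hy hz hH)
  rw [add_lie, ← lie_skew z, lie_eq_zero_of_isCompl hIC x.2 hz, neg_zero, add_zero]
  exact h1

/-- The projection of `𝔥` onto `𝔥 ∩ I` along a complementary ideal. -/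
noncomputable def cartanProj (𝔥 : LieSubalgebra ℂ 𝔤) [𝔥.IsCartanSubalgebra] (hIC : IsCompl I C) :
    𝔥 →ₗ[ℂ] idealCartan 𝔥 I :=
  (((Submodule.projectionOnto I.toSubmodule C.toSubmodule
    (LieSubmodule.isCompl_toSubmodule.mpr hIC)).comp 𝔥.toSubmodule.subtype).codRestrict
    (idealCartan 𝔥 I).toSubmodule fun H => by
      obtain ⟨y, hy, z, hz, e⟩ := exists_add_of_isCompl hIC (H : 𝔤)
      have h1 := cartan_component_mem hIC hy hz (e ▸ H.2)
      change ((Submodule.projectionOnto I.toSubmodule C.toSubmodule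
        (LieSubmodule.isCompl_toSubmodule.mpr hIC) (H : 𝔤) : I) : 𝔤) ∈ 𝔥
      have h2 : Submodule.projectionOnto I.toSubmodule C.toSubmodule
          (LieSubmodule.isCompl_toSubmodule.mpr hIC) (H : 𝔤) = ⟨y, hy⟩ := by
        rw [← e, map_add, Submodule.projectionOnto_apply_of_mem_right _ hz, add_zero]
        exact Submodule.projectionOnto_apply_left _ ⟨y, hy⟩
      rw [h2]
      exact h1)

lemma cartanProj_eq (hIC : IsCompl I C) {H : 𝔥} {y z : 𝔤} (hy : y ∈ I) (hz : z ∈ C)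
    (e : y + z = H) : ((cartanProj 𝔥 hIC H : I) : 𝔤) = y := by
  change ((Submodule.projectionOnto I.toSubmodule C.toSubmodule
    (LieSubmodule.isCompl_toSubmodule.mpr hIC) (H : 𝔤) : I) : 𝔤) = y
  rw [← e, map_add, Submodule.projectionOnto_apply_of_mem_right _ hz, add_zero]
  exact congrArg Subtype.val (Submodule.projectionOnto_apply_left _ (⟨y, hy⟩ : I.toSubmodule))

lemma sub_cartanProj_mem (hIC : IsCompl I C) (H : 𝔥) :
    (H : 𝔤) - ((cartanProj 𝔥 hIC H : I) : 𝔤) ∈ C := by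
  obtain ⟨y, hy, z, hz, e⟩ := exists_add_of_isCompl hIC (H : 𝔤)
  rw [cartanProj_eq hIC hy hz e, ← e, add_sub_cancel_left]
  exact hz

/-- The extension by zero of a linear form on `𝔥 ∩ I`. -/
noncomputable def extendDual (𝔥 : LieSubalgebra ℂ 𝔤) [𝔥.IsCartanSubalgebra] (hIC : IsCompl I C) :
    Module.Dual ℂ (idealCartan 𝔥 I) →ₗ[ℂ] Module.Dual ℂ 𝔥 :=
  (cartanProj 𝔥 hIC).dualMap

lemma restrictToIdeal_extendDual (hIC : IsCompl I C) (δ : Module.Dual ℂ (idealCartan 𝔥 I)) :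
    restrictToIdeal I (extendDual 𝔥 hIC δ) = δ := by
  refine LinearMap.ext fun H => ?_
  change δ (cartanProj 𝔥 hIC ⟨((H : I) : 𝔤), H.2⟩) = δ H
  congr 1
  refine Subtype.ext (Subtype.ext ?_)
  exact cartanProj_eq hIC (H : I).2 (zero_mem C) (add_zero _)

lemma extendDual_injective (hIC : IsCompl I C) : Function.Injective (extendDual 𝔥 hIC) :=
  Function.LeftInverse.injective (restrictToIdeal_extendDual hIC)

/-- The part of 𝔥 in C kills I, so a weight vector in I has the weight extended by zero. -/
lemma mem_rootSpace_extendDual (hIC : IsCompl I C) {δ : Module.Dual ℂ (idealCartan 𝔥 I)} {x : I} :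
    x ∈ rootSpace (idealCartan 𝔥 I) δ ↔ (x : 𝔤) ∈ rootSpace 𝔥 (extendDual 𝔥 hIC δ) := by
  rw [mem_rootSpace, mem_rootSpace]
  constructor
  · intro h H
    have h1 := congrArg Subtype.val (h (cartanProj 𝔥 hIC H))
    change ⁅((cartanProj 𝔥 hIC H : I) : 𝔤), (x : 𝔤)⁆ = δ (cartanProj 𝔥 hIC H) • (x : 𝔤) at h1
    have h2 : ⁅(H : 𝔤) - ((cartanProj 𝔥 hIC H : I) : 𝔤), (x : 𝔤)⁆ = 0 := by
      rw [← lie_skew, lie_eq_zero_of_isCompl hIC x.2 (sub_cartanProj_mem hIC H), neg_zero]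
    rw [sub_lie, sub_eq_zero] at h2
    rw [h2, h1]
    rfl
  · intro h H
    refine Subtype.ext ?_
    have h1 := h ⟨((H : I) : 𝔤), H.2⟩
    change ⁅((H : I) : 𝔤), (x : 𝔤)⁆ = δ H • (x : 𝔤)
    rw [h1]
    congr 1
    exact LinearMap.congr_fun (restrictToIdeal_extendDual hIC δ) H

/-- Choose H in 𝔥 ∩ I with δ(H) ≠ 0; then x is a multiple of [H, x], which lies in I. -/
lemma rootSpace_extendDual_le (hIC : IsCompl I C) {δ : Module.Dual ℂ (idealCartan 𝔥 I)}
    (hδ : δ ≠ 0) : rootSpace 𝔥 (extendDual 𝔥 hIC δ) ≤ I.toSubmodule := by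
  intro x hx
  obtain ⟨H, hH⟩ : ∃ H, δ H ≠ 0 := by
    by_contra! h
    exact hδ (LinearMap.ext h)
  have h1 := mem_rootSpace.mp hx ⟨((H : I) : 𝔤), H.2⟩
  have h2 : extendDual 𝔥 hIC δ ⟨((H : I) : 𝔤), H.2⟩ = δ H :=
    LinearMap.congr_fun (restrictToIdeal_extendDual hIC δ) H
  rw [h2] at h1
  have h3 : ⁅((H : I) : 𝔤), x⁆ ∈ I.toSubmodule := lie_mem_left ℂ 𝔤 I _ x (H : I).2
  change ⁅((H : I) : 𝔤), x⁆ = _ at h1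
  rw [h1] at h3
  exact (Submodule.smul_mem_iff _ hH).mp h3

lemma mem_roots_extendDual (hIC : IsCompl I C) {δ : Module.Dual ℂ (idealCartan 𝔥 I)} :
    δ ∈ roots (idealCartan 𝔥 I) ↔ extendDual 𝔥 hIC δ ∈ roots 𝔥 := by
  have h0 : extendDual 𝔥 hIC δ = 0 ↔ δ = 0 :=
    map_eq_zero_iff _ (extendDual_injective hIC)
  refine Iff.trans (b := extendDual 𝔥 hIC δ ≠ 0 ∧
    rootSpace 𝔥 (extendDual 𝔥 hIC δ) ⊓ I.toSubmodule ≠ ⊥)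
    (and_congr (not_congr h0.symm) ?_) ?_
  · rw [Submodule.ne_bot_iff, Submodule.ne_bot_iff]
    constructor
    · rintro ⟨x, hx, h⟩
      exact ⟨x, ⟨(mem_rootSpace_extendDual hIC).mp hx, x.2⟩, fun h' => h (Subtype.ext h')⟩
    · rintro ⟨x, ⟨hx, hxI⟩, h⟩
      exact ⟨⟨x, hxI⟩, (mem_rootSpace_extendDual hIC).mpr hx,
        fun h' => h (congrArg Subtype.val h')⟩
  · refine and_congr_right fun hne => ?_
    rw [inf_eq_left.mpr (rootSpace_extendDual_le hIC (h0.not.mp hne))]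

/-- A root whose root space lies in I vanishes on the C-part of 𝔥, hence is recovered from its
restriction. -/
lemma extendDual_restrictToIdeal (hIC : IsCompl I C) {γ : Module.Dual ℂ 𝔥} (hγ : γ ∈ roots 𝔥)
    (hI : rootSpace 𝔥 γ ≤ I.toSubmodule) : extendDual 𝔥 hIC (restrictToIdeal I γ) = γ := by
  refine LinearMap.ext fun H => ?_
  obtain ⟨x, hx, h0⟩ := exists_ne_zero_of_mem_roots hγ
  set H' : 𝔥 := ⟨((cartanProj 𝔥 hIC H : I) : 𝔤), (cartanProj 𝔥 hIC H).2⟩ with hH'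
  change γ H' = γ H
  have h1 : ⁅((H - H' : 𝔥) : 𝔤), x⁆ = 0 := by
    rw [← lie_skew]
    have : ((H - H' : 𝔥) : 𝔤) ∈ C := sub_cartanProj_mem hIC H
    rw [lie_eq_zero_of_isCompl hIC (hI hx) this, neg_zero]
  rw [mem_rootSpace.mp hx, map_sub] at h1
  exact (sub_eq_zero.mp ((smul_eq_zero.mp h1).resolve_right h0)).symm

variable {P : Set (Module.Dual ℂ 𝔥)}

lemma mem_idealPositive_iff (hP : IsPositiveSystem 𝔥 P) (hIC : IsCompl I C)
    {δ : Module.Dual ℂ (idealCartan 𝔥 I)} :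
    δ ∈ idealPositive P I ↔ extendDual 𝔥 hIC δ ∈ P := by
  constructor
  · rintro ⟨γ, ⟨hγ, hγI⟩, rfl⟩
    rwa [extendDual_restrictToIdeal hIC (hP.subset_roots hγ) hγI]
  · intro h
    have hδ := (mem_roots_extendDual hIC).mpr (hP.subset_roots h)
    exact ⟨extendDual 𝔥 hIC δ, ⟨h, rootSpace_extendDual_le hIC hδ.1⟩,
      restrictToIdeal_extendDual hIC δ⟩

lemma isPositiveSystem_idealPositive (hP : IsPositiveSystem 𝔥 P) (hIC : IsCompl I C) :
    IsPositiveSystem (idealCartan 𝔥 I) (idealPositive P I) where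
  subset_roots δ hδ := (mem_roots_extendDual hIC).mpr
    (hP.subset_roots ((mem_idealPositive_iff hP hIC).mp hδ))
  mem_or_neg_mem δ hδ := by
    simp only [mem_idealPositive_iff hP hIC, map_neg]
    exact hP.mem_or_neg_mem _ ((mem_roots_extendDual hIC).mp hδ)
  neg_notMem δ hδ := by
    rw [mem_idealPositive_iff hP hIC] at *
    rw [map_neg]
    exact hP.neg_notMem _ hδ
  add_mem δ hδ ε hε hr := by
    rw [mem_idealPositive_iff hP hIC] at *
    rw [mem_roots_extendDual hIC] at hr
    rw [map_add] at *
    exact hP.add_mem _ hδ _ hε hr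

lemma mem_noncompactRoots_extendDual (hP : IsPositiveSystem 𝔥 P) (hIC : IsCompl I C)
    {δ : Module.Dual ℂ (idealCartan 𝔥 I)} :
    δ ∈ noncompactRoots (restrictInvolution θ hinv I hθI) (idealPositive P I) ↔
      extendDual 𝔥 hIC δ ∈ noncompactRoots θ P := by
  refine (and_congr_left' (mem_idealPositive_iff hP hIC)).trans (and_congr_right fun h => ?_)
  have hδ := (mem_roots_extendDual hIC).mpr (hP.subset_roots h)
  constructor
  · intro h1 x hx
    have hxI := rootSpace_extendDual_le hIC hδ.1 hx
    exact (mem_pp_restrictInvolution hinv hθI).mp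
      (h1 ((mem_rootSpace_extendDual hIC (x := ⟨x, hxI⟩)).mpr hx))
  · intro h1 x hx
    exact (mem_pp_restrictInvolution hinv hθI).mpr (h1 ((mem_rootSpace_extendDual hIC).mp hx))

lemma mem_pPlus_restrictInvolution (hP : IsPositiveSystem 𝔥 P)
    (hIC : IsCompl I C) {x : I} :
    x ∈ pPlus (restrictInvolution θ hinv I hθI) (idealPositive P I) ↔ (x : 𝔤) ∈ pPlus θ P := by
  constructor
  · intro hx
    have : pPlus (restrictInvolution θ hinv I hθI) (idealPositive P I) ≤
        (pPlus θ P).comap I.toSubmodule.subtype := by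
      refine rootSum_le fun δ hδ y hy => ?_
      exact rootSpace_le_rootSum ((mem_noncompactRoots_extendDual hinv hθI hP hIC).mp hδ)
        ((mem_rootSpace_extendDual hIC).mp hy)
    exact this hx
  · intro hx
    -- Being 𝔥-stable, 𝔭⁺ ∩ I is a sum of root spaces, each of which lies in I and comes from a root
    -- of I.
    have hst : ∀ H ∈ 𝔥, ∀ y ∈ pPlus θ P ⊓ I.toSubmodule, ⁅H, y⁆ ∈ pPlus θ P ⊓ I.toSubmodule := by
      rintro H hH y ⟨hy, hyI⟩
      refine ⟨?_, lie_mem_right ℂ 𝔤 I H y hyI⟩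
      have : pPlus θ P ≤ (pPlus θ P).comap (LieAlgebra.ad ℂ 𝔤 H) :=
        rootSum_le fun γ hγ z hz => by
          change ⁅H, z⁆ ∈ pPlus θ P
          have h1 : ⁅H, z⁆ = γ ⟨H, hH⟩ • z := mem_rootSpace.mp hz ⟨H, hH⟩
          rw [h1]
          exact Submodule.smul_mem _ _ (rootSpace_le_rootSum hγ hz)
      exact this hy
    have hle : pPlus θ P ⊓ I.toSubmodule ≤
        (pPlus (restrictInvolution θ hinv I hθI) (idealPositive P I)).map
          I.toSubmodule.subtype := by
      rw [eq_iSup_inf_rootSpace (𝔥 := 𝔥) _ hst]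
      refine iSup_le fun γ => ?_
      by_cases hb : pPlus θ P ⊓ I.toSubmodule ⊓ rootSpace 𝔥 γ = ⊥
      · rw [hb]; exact bot_le
      have hγ : γ ∈ noncompactRoots θ P := by
        refine mem_of_rootSpace_inf_rootSum_ne_bot fun h => hb ?_
        exact le_bot_iff.mp ((inf_le_inf_right _ inf_le_left).trans h.le)
      have hγr := hP.subset_roots hγ.1
      have hγI : rootSpace 𝔥 γ ≤ I.toSubmodule :=
        ((inf_eq_bot_or_rootSpace_le hγr _).resolve_left hb).trans inf_le_right
      have e := extendDual_restrictToIdeal hIC hγr hγI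
      intro y hy
      refine ⟨⟨y, hy.1.2⟩, ?_, rfl⟩
      have h1 : restrictToIdeal I γ ∈
          noncompactRoots (restrictInvolution θ hinv I hθI) (idealPositive P I) := by
        rw [mem_noncompactRoots_extendDual hinv hθI hP hIC, e]
        exact hγ
      refine rootSpace_le_rootSum h1 ?_
      rw [mem_rootSpace_extendDual hIC, e]
      exact hy.2
    obtain ⟨z, hz, e⟩ := hle ⟨hx, x.2⟩
    rwa [← Subtype.ext (a1 := z) (a2 := x) e]

/-- Total positivity is inherited by `θ`-stable ideals with a complement. -/
lemma IsTotallyPositive.restrict (h : IsTotallyPositive θ P) (hIC : IsCompl I C) :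
    IsTotallyPositive (restrictInvolution θ h.involutive I hθI) (idealPositive P I) where
  involutive x := Subtype.ext (h.involutive x)
  cartan_le x hx := Subtype.ext (h.cartan_le hx)
  positive := isPositiveSystem_idealPositive h.positive hIC
  total := by
    have hpP := fun x => mem_pPlus_restrictInvolution (x := x) h.involutive hθI h.positive hIC
    refine Set.Subset.antisymm (fun δ hδ => ?_) fun δ hδ => ?_
    -- The stable subspace witnessing total positivity is the whole positive non-compact part of I.
    · refine ⟨(isPositiveSystem_idealPositive h.positive hIC).subset_roots hδ.1,
        { pPlus (restrictInvolution θ h.involutive I hθI) (idealPositive P I) with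
          lie_mem := fun {x m} hm => ?_ }, le_rfl, rootSpace_le_rootSum hδ⟩
      refine (hpP _).mpr (h.lie_mem_pPlus ?_ ((hpP m).mp hm))
      exact (mem_kk_restrictInvolution h.involutive hθI).mp x.2
    · obtain ⟨hδr, m, hm, hδm⟩ := hδ
      have hr := (mem_roots_extendDual hIC).mp hδr
      rw [mem_noncompactRoots_extendDual h.involutive hθI h.positive hIC]
      refine mem_of_rootSpace_le_rootSum hr fun x hx => ?_
      have hxI := rootSpace_extendDual_le hIC hδr.1 hx
      exact (hpP ⟨x, hxI⟩).mp (hm (hδm ((mem_rootSpace_extendDual hIC).mpr hx)))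

end Ideals

end HarishChandra

/-! ### The ideals 𝔤_i -/

namespace HarishChandra

lemma mem_of_mem_bracket {𝔤 : Type*} [LieRing 𝔤] [LieAlgebra ℂ 𝔤] {V W N : Submodule ℂ 𝔤}
    (h : ∀ x ∈ V, ∀ y ∈ W, ⁅x, y⁆ ∈ N) {z : 𝔤} (hz : z ∈ bracket V W) : z ∈ N := by
  refine (Submodule.span_le (p := N)).mpr ?_ hz
  rintro _ ⟨x, hx, y, hy, rfl⟩
  exact h x hx y hy

lemma lie_mem_bracket {𝔤 : Type*} [LieRing 𝔤] [LieAlgebra ℂ 𝔤] {V W : Submodule ℂ 𝔤} {x y : 𝔤}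
    (hx : x ∈ V) (hy : y ∈ W) : ⁅x, y⁆ ∈ bracket V W :=
  Submodule.subset_span ⟨x, hx, y, hy, rfl⟩

/-- The subspace of all `x` with `[x, N] ⊆ M`. -/
def transporter {𝔤 : Type*} [LieRing 𝔤] [LieAlgebra ℂ 𝔤] (N M : Submodule ℂ 𝔤) :
    Submodule ℂ 𝔤 where
  carrier := {x | ∀ y ∈ N, ⁅x, y⁆ ∈ M}
  add_mem' {a b} ha hb y hy := by rw [add_lie]; exact add_mem (ha y hy) (hb y hy)
  zero_mem' y _ := by rw [zero_lie]; exact zero_mem _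
  smul_mem' c a ha y hy := by rw [smul_lie]; exact Submodule.smul_mem _ _ (ha y hy)

lemma lie_eq_zero_of_rootSum {𝔤 : Type*} [LieRing 𝔤] [LieAlgebra ℂ 𝔤] {𝔥 : LieSubalgebra ℂ 𝔤}
    {Q Q' : Set (Module.Dual ℂ 𝔥)}
    (h : ∀ γ ∈ Q, ∀ δ ∈ Q', γ + δ ≠ 0 ∧ γ + δ ∉ roots 𝔥) {x y : 𝔤} (hx : x ∈ rootSum Q)
    (hy : y ∈ rootSum Q') : ⁅x, y⁆ = 0 := by
  have h1 : rootSum Q ≤ transporter (rootSum Q') ⊥ := by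
    refine rootSum_le fun γ hγ x hx y hy => ?_
    have : rootSum Q' ≤ LinearMap.ker (LieAlgebra.ad ℂ 𝔤 x) := rootSum_le fun δ hδ y hy =>
      lie_eq_zero_of_add_notMem (h γ hγ δ hδ).1 (h γ hγ δ hδ).2 hx hy
    exact (Submodule.mem_bot ℂ).mpr (this hy)
  exact (Submodule.mem_bot ℂ).mp (h1 hx y hy)

/-- The roots in `pieceRoots θ P β` and their negatives. -/
def signedPieceRoots {𝔤 : Type*} [LieRing 𝔤] [LieAlgebra ℂ 𝔤] (θ : 𝔤 ≃ₗ⁅ℂ⁆ 𝔤)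
    {𝔥 : LieSubalgebra ℂ 𝔤} (P : Set (Module.Dual ℂ 𝔥)) (β : Module.Dual ℂ 𝔥) :
    Set (Module.Dual ℂ 𝔥) :=
  pieceRoots θ P β ∪ {γ | -γ ∈ pieceRoots θ P β}

lemma rootSum_union {𝔤 : Type*} [LieRing 𝔤] [LieAlgebra ℂ 𝔤] {𝔥 : LieSubalgebra ℂ 𝔤}
    (Q Q' : Set (Module.Dual ℂ 𝔥)) : (rootSum (Q ∪ Q') : Submodule ℂ 𝔤) = rootSum Q ⊔ rootSum Q' :=
  iSup_union

variable {𝔤 : Type*} [LieRing 𝔤] [LieAlgebra ℂ 𝔤] {θ : 𝔤 ≃ₗ⁅ℂ⁆ 𝔤} {𝔥 : LieSubalgebra ℂ 𝔤}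
  {P : Set (Module.Dual ℂ 𝔥)}

namespace IsTotallyPositive

variable [FiniteDimensional ℂ 𝔤] [LieAlgebra.IsKilling ℂ 𝔤] [𝔥.IsCartanSubalgebra]

lemma withNegative_piece (h : IsTotallyPositive θ P) (β : Module.Dual ℂ 𝔥) :
    withNegative 𝔥 (piece θ P β) = rootSum (signedPieceRoots θ P β) := by
  rw [signedPieceRoots, rootSum_union]
  have : {γ : Module.Dual ℂ 𝔥 | -γ ∈ roots 𝔥 ∧ rootSpace 𝔥 (-γ) ≤ piece θ P β} =
      {γ | -γ ∈ pieceRoots θ P β} := by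
    ext γ
    exact ⟨fun hγ => (rootSpace_le_piece_iff hγ.1).mp hγ.2, fun hγ =>
      ⟨h.positive.subset_roots (show -γ ∈ pieceRoots θ P β from hγ).1.1, rootSpace_le_rootSum hγ⟩⟩
  rw [withNegative, this]
  rfl

lemma signedPieceRoots_roots (h : IsTotallyPositive θ P) {β γ : Module.Dual ℂ 𝔥}
    (hγ : γ ∈ signedPieceRoots θ P β) : γ ∈ roots 𝔥 ∧ rootSpace 𝔥 γ ≤ pp θ := by
  rcases hγ with hγ | hγ
  · exact ⟨h.positive.subset_roots hγ.1.1, hγ.1.2⟩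
  · have h1 := h.positive.subset_roots hγ.1.1
    have h2 := neg_mem_roots h1
    have h3 := rootSpace_neg_le_pp h.involutive h.cartan_le h1 hγ.1.2
    rw [neg_neg] at h2 h3
    exact ⟨h2, h3⟩

lemma withNegative_le_pp (h : IsTotallyPositive θ P) (β : Module.Dual ℂ 𝔥) :
    withNegative 𝔥 (piece θ P β) ≤ pp θ := by
  rw [h.withNegative_piece]
  exact rootSum_le fun γ hγ => (h.signedPieceRoots_roots hγ).2

lemma lie_mem_withNegative (h : IsTotallyPositive θ P) (β : Module.Dual ℂ 𝔥) {x y : 𝔤}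
    (hx : x ∈ kk θ) (hy : y ∈ withNegative 𝔥 (piece θ P β)) :
    ⁅x, y⁆ ∈ withNegative 𝔥 (piece θ P β) := by
  rw [h.withNegative_piece, signedPieceRoots, rootSum_union] at *
  obtain ⟨a, ha, b, hb, rfl⟩ := Submodule.mem_sup.mp hy
  rw [lie_add]
  exact add_mem (Submodule.mem_sup_left (h.lie_mem_piece β hx ha))
    (Submodule.mem_sup_right (h.lie_mem_rootSum_neg_pieceRoots β hx hb))

/-- Differences of roots of different pieces are neither zero nor roots. -/
lemma sub_notMem_roots (h : IsTotallyPositive θ P) {β β' γ δ : Module.Dual ℂ 𝔥}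
    (hβ : β ∈ noncompactSimpleRoots θ P) (hβ' : β' ∈ noncompactSimpleRoots θ P) (hne : β ≠ β')
    (hγ : γ ∈ pieceRoots θ P β) (hδ : δ ∈ pieceRoots θ P β') :
    γ + -δ ≠ 0 ∧ γ + -δ ∉ roots 𝔥 := by
  -- A relation modulo the compact span would put γ in both pieces. A root γ - δ would be compact,
  -- since [𝔭, 𝔭] ⊆ 𝔨, and hence lie in that span.
  have hspan : γ + -δ ∉ Submodule.span ℂ (simpleRoots (compactRoots θ P)) := by
    intro hs
    refine hne (h.eq_of_mem_pieceRoots hβ hβ' (γ := γ) hγ ⟨hγ.1, ?_⟩)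
    have := add_mem hs hδ.2
    rwa [← sub_eq_add_neg, sub_add_sub_cancel] at this
  refine ⟨fun h0 => hspan (h0 ▸ zero_mem _), fun hr => hspan ?_⟩
  have hγr := h.positive.subset_roots hγ.1.1
  have hδr := h.positive.subset_roots hδ.1.1
  refine h.mem_span_of_compact hr (rootSpace_add_le hγr (neg_mem_roots hδr) hr
    fun x hx y hy => lie_mem_kk_of_pp (hγ.1.2 hx) ?_)
  exact rootSpace_neg_le_pp h.involutive h.cartan_le hδr hδ.1.2 hy

/-- For equal signs the sum of two non-compact positive roots is never a root; for opposite signs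
the difference crosses two pieces. -/
lemma lie_withNegative_eq_zero (h : IsTotallyPositive θ P) {β β' : Module.Dual ℂ 𝔥}
    (hβ : β ∈ noncompactSimpleRoots θ P) (hβ' : β' ∈ noncompactSimpleRoots θ P) (hne : β ≠ β')
    {x y : 𝔤} (hx : x ∈ withNegative 𝔥 (piece θ P β)) (hy : y ∈ withNegative 𝔥 (piece θ P β')) :
    ⁅x, y⁆ = 0 := by
  rw [h.withNegative_piece] at hx hy
  have hneg : ∀ γ : Module.Dual ℂ 𝔥, (-γ ≠ 0 ∧ -γ ∉ roots 𝔥) → γ ≠ 0 ∧ γ ∉ roots 𝔥 :=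
    fun γ hγ => ⟨fun h0 => hγ.1 (by rw [h0, neg_zero]), fun hr => hγ.2 (neg_mem_roots hr)⟩
  refine lie_eq_zero_of_rootSum (fun γ hγ δ hδ => ?_) hx hy
  rcases hγ with hγ | hγ <;> rcases hδ with hδ | hδ
  · exact ⟨h.add_ne_zero hγ.1.1 hδ.1.1, h.add_notMem_roots hγ.1 hδ.1⟩
  · simpa using h.sub_notMem_roots hβ hβ' hne hγ hδ
  · have := h.sub_notMem_roots hβ' hβ hne.symm hδ hγ
    rwa [neg_neg, add_comm] at this
  · refine hneg _ ?_
    rw [neg_add]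
    exact ⟨h.add_ne_zero hγ.1.1 hδ.1.1, h.add_notMem_roots hγ.1 hδ.1⟩

lemma pTotal_le (h : IsTotallyPositive θ P) {N : Submodule ℂ 𝔤}
    (hN : ∀ β ∈ noncompactSimpleRoots θ P, withNegative 𝔥 (piece θ P β) ≤ N) :
    pTotal θ P ≤ N := by
  have h1 : ∀ γ ∈ noncompactRoots θ P, rootSpace 𝔥 γ ≤ N ∧ rootSpace 𝔥 (-γ) ≤ N := by
    intro γ hγ
    obtain ⟨β, hβ, hγβ⟩ := h.exists_mem_pieceRoots hγ
    have h2 := hN β hβ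
    rw [h.withNegative_piece] at h2
    refine ⟨(rootSpace_le_rootSum (Or.inl hγβ)).trans h2,
      (rootSpace_le_rootSum (Or.inr ?_)).trans h2⟩
    change - -γ ∈ pieceRoots θ P β
    rwa [neg_neg]
  rw [pTotal, ← h.total]
  refine sup_le (rootSum_le fun γ hγ => (h1 γ hγ).1) (rootSum_le fun γ hγ => ?_)
  have := (h1 (-γ) hγ).2
  rwa [neg_neg] at this

lemma pTotal_le_pp (h : IsTotallyPositive θ P) : pTotal θ P ≤ pp θ :=
  h.pTotal_le fun β _ => h.withNegative_le_pp β

/-- A subspace containing `𝔨` and all `𝔭_i` contains `𝔤_t`. -/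
lemma gTotal_le (h : IsTotallyPositive θ P) {N : Submodule ℂ 𝔤}
    (hk : (kk θ).toSubmodule ≤ N)
    (hN : ∀ β ∈ noncompactSimpleRoots θ P, withNegative 𝔥 (piece θ P β) ≤ N) :
    gTotal θ P ≤ N :=
  sup_le (fun _ hz => hk (mem_of_mem_bracket (N := (kk θ).toSubmodule)
    (fun _ hx _ hy => lie_mem_kk_of_pp (h.pTotal_le_pp hx) (h.pTotal_le_pp hy)) hz))
    (h.pTotal_le hN)

/-- An element commuting with all `𝔭_i` is zero, if `𝔤 = 𝔤_t`. -/
lemma eq_zero_of_lie_withNegative (h : IsTotallyPositive θ P) (hg : gTotal θ P = ⊤) {x : 𝔤}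
    (hx : ∀ β ∈ noncompactSimpleRoots θ P, ∀ y ∈ withNegative 𝔥 (piece θ P β), ⁅x, y⁆ = 0) :
    x = 0 := by
  have h1 : pTotal θ P ≤ LinearMap.ker (LieAlgebra.ad ℂ 𝔤 x) := h.pTotal_le fun β hβ y hy =>
    hx β hβ y hy
  have h2 : gTotal θ P ≤ LinearMap.ker (LieAlgebra.ad ℂ 𝔤 x) := by
    refine sup_le (fun z hz => mem_of_mem_bracket (fun a ha b hb => ?_) hz) h1
    have ha0 : ⁅x, a⁆ = 0 := h1 ha
    have hb0 : ⁅x, b⁆ = 0 := h1 hb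
    change ⁅x, ⁅a, b⁆⁆ = 0
    rw [leibniz_lie, ha0, hb0, zero_lie, lie_zero, add_zero]
  refine eq_zero_of_forall_lie fun y => ?_
  have h3 : ⁅x, y⁆ = 0 := h2 (hg ▸ Submodule.mem_top)
  rw [← lie_skew, h3, neg_zero]

lemma bracket_withNegative_le_kk (h : IsTotallyPositive θ P) (β : Module.Dual ℂ 𝔥) :
    bracket (withNegative 𝔥 (piece θ P β)) (withNegative 𝔥 (piece θ P β)) ≤
      (kk θ).toSubmodule := fun _ hz =>
  mem_of_mem_bracket (fun _ hx _ hy => lie_mem_kk_of_pp (h.withNegative_le_pp β hx)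
    (h.withNegative_le_pp β hy)) hz

lemma lie_bracket_withNegative_eq_zero (h : IsTotallyPositive θ P) {β β' : Module.Dual ℂ 𝔥}
    (hβ : β ∈ noncompactSimpleRoots θ P) (hβ' : β' ∈ noncompactSimpleRoots θ P) (hne : β ≠ β')
    {x y : 𝔤} (hx : x ∈ withNegative 𝔥 (piece θ P β)) (hy : y ∈ bracket
      (withNegative 𝔥 (piece θ P β')) (withNegative 𝔥 (piece θ P β')) ⊔
        withNegative 𝔥 (piece θ P β')) : ⁅x, y⁆ = 0 := by
  have h1 : withNegative 𝔥 (piece θ P β') ≤ LinearMap.ker (LieAlgebra.ad ℂ 𝔤 x) := fun y hy =>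
    h.lie_withNegative_eq_zero hβ hβ' hne hx hy
  refine sup_le (c := LinearMap.ker (LieAlgebra.ad ℂ 𝔤 x))
    (fun z hz => mem_of_mem_bracket (fun a ha b hb => ?_) hz) h1 hy
  have ha0 : ⁅x, a⁆ = 0 := h1 ha
  have hb0 : ⁅x, b⁆ = 0 := h1 hb
  change ⁅x, ⁅a, b⁆⁆ = 0
  rw [leibniz_lie, ha0, hb0, zero_lie, lie_zero, add_zero]

/-- The ideal `𝔤_i = [𝔭_i, 𝔭_i] ⊕ 𝔭_i`, when `𝔤 = 𝔤_t`. -/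
noncomputable def pieceIdeal (h : IsTotallyPositive θ P) (hg : gTotal θ P = ⊤) {β : Module.Dual ℂ 𝔥}
    (hβ : β ∈ noncompactSimpleRoots θ P) : LieIdeal ℂ 𝔤 where
  __ := bracket (withNegative 𝔥 (piece θ P β)) (withNegative 𝔥 (piece θ P β)) ⊔
    withNegative 𝔥 (piece θ P β)
  lie_mem {x y} hy := by
    set p := withNegative 𝔥 (piece θ P β) with hp
    -- As 𝔤 = 𝔤_t, it is enough that 𝔨 and every 𝔭_j preserve the subspace.
    have hk : (kk θ).toSubmodule ≤ transporter (bracket p p ⊔ p) (bracket p p ⊔ p) := by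
      intro x hx y hy
      obtain ⟨a, ha, b, hb, rfl⟩ := Submodule.mem_sup.mp hy
      rw [lie_add]
      refine add_mem (Submodule.mem_sup_left ?_)
        (Submodule.mem_sup_right (h.lie_mem_withNegative β hx hb))
      refine mem_of_mem_bracket (N := (bracket p p).comap (LieAlgebra.ad ℂ 𝔤 x))
        (fun u hu v hv => ?_) ha
      change ⁅x, ⁅u, v⁆⁆ ∈ bracket p p
      rw [leibniz_lie]
      exact add_mem (lie_mem_bracket (h.lie_mem_withNegative β hx hu) hv)
        (lie_mem_bracket hu (h.lie_mem_withNegative β hx hv))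
    -- The piece's own 𝔭_i exchanges 𝔨_i and 𝔭_i; every other 𝔭_j acts by zero.
    have := h.gTotal_le hk fun β' hβ' x hx y hy => by
      by_cases hne : β' = β
      · subst hne
        obtain ⟨a, ha, b, hb, rfl⟩ := Submodule.mem_sup.mp hy
        rw [lie_add]
        refine add_mem (Submodule.mem_sup_right ?_) (Submodule.mem_sup_left (lie_mem_bracket hx hb))
        rw [← lie_skew]
        exact neg_mem (h.lie_mem_withNegative β' (h.bracket_withNegative_le_kk β' ha) hx)
      · rw [h.lie_bracket_withNegative_eq_zero hβ' hβ hne hx hy]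
        exact zero_mem _
    rw [hg] at this
    exact this (Submodule.mem_top (x := x)) y hy

variable (h : IsTotallyPositive θ P) (hg : gTotal θ P = ⊤) {β : Module.Dual ℂ 𝔥}
  (hβ : β ∈ noncompactSimpleRoots θ P)

lemma pieceIdeal_toSubmodule : (h.pieceIdeal hg hβ).toSubmodule =
    bracket (withNegative 𝔥 (piece θ P β)) (withNegative 𝔥 (piece θ P β)) ⊔
      withNegative 𝔥 (piece θ P β) := rfl

lemma withNegative_le_pieceIdeal :
    withNegative 𝔥 (piece θ P β) ≤ (h.pieceIdeal hg hβ).toSubmodule :=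
  le_sup_right

lemma pieceIdeal_inf_kk : (h.pieceIdeal hg hβ).toSubmodule ⊓ (kk θ).toSubmodule =
    bracket (withNegative 𝔥 (piece θ P β)) (withNegative 𝔥 (piece θ P β)) := by
  rw [pieceIdeal_toSubmodule, sup_inf_assoc_of_le _ (h.bracket_withNegative_le_kk β),
    (disjoint_kk_pp.symm.mono_left (h.withNegative_le_pp β)).eq_bot, sup_bot_eq]

lemma pieceIdeal_inf_pp : (h.pieceIdeal hg hβ).toSubmodule ⊓ pp θ =
    withNegative 𝔥 (piece θ P β) := by
  rw [pieceIdeal_toSubmodule, sup_comm, sup_inf_assoc_of_le _ (h.withNegative_le_pp β),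
    (disjoint_kk_pp.mono_left (h.bracket_withNegative_le_kk β)).eq_bot, sup_bot_eq]

lemma map_mem_pieceIdeal {x : 𝔤} (hx : x ∈ h.pieceIdeal hg hβ) : θ x ∈ h.pieceIdeal hg hβ := by
  obtain ⟨a, ha, b, hb, rfl⟩ := Submodule.mem_sup.mp hx
  have h1 := mem_kk.mp (h.bracket_withNegative_le_kk β ha)
  have h2 := mem_pp.mp (h.withNegative_le_pp β hb)
  rw [map_add, h1, h2]
  exact Submodule.add_mem_sup ha (neg_mem hb)

lemma lie_pieceIdeal_eq_zero {β' : Module.Dual ℂ 𝔥} (hβ' : β' ∈ noncompactSimpleRoots θ P)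
    (hne : β ≠ β') {x y : 𝔤} (hx : x ∈ h.pieceIdeal hg hβ) (hy : y ∈ h.pieceIdeal hg hβ') :
    ⁅x, y⁆ = 0 := by
  have h1 : ∀ a ∈ withNegative 𝔥 (piece θ P β), ⁅y, a⁆ = 0 := fun a ha => by
    rw [← lie_skew, h.lie_bracket_withNegative_eq_zero hβ hβ' hne ha hy, neg_zero]
  have h2 : (h.pieceIdeal hg hβ).toSubmodule ≤ LinearMap.ker (LieAlgebra.ad ℂ 𝔤 y) := by
    refine sup_le (fun z hz => mem_of_mem_bracket (fun a ha b hb => ?_) hz) h1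
    change ⁅y, ⁅a, b⁆⁆ = 0
    rw [leibniz_lie, h1 a ha, h1 b hb, zero_lie, lie_zero, add_zero]
  have h3 : ⁅y, x⁆ = 0 := h2 hx
  rw [← lie_skew, h3, neg_zero]

/-- A nonzero ideal inside `𝔤_i` is equal to `𝔤_i`. -/
lemma isAtom_pieceIdeal [ComplementedLattice (LieSubmodule ℂ (kk θ) 𝔤)] :
    IsAtom (h.pieceIdeal hg hβ) := by
  have hβr := h.mem_roots_of_simple hβ
  refine ⟨fun h0 => ?_, fun J hJ => ?_⟩
  · obtain ⟨x, hx, hx0⟩ := exists_ne_zero_of_mem_roots hβr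
    have : x ∈ h.pieceIdeal hg hβ := h.withNegative_le_pieceIdeal hg hβ
      (le_sup_left (a := piece θ P β) (rootSpace_le_rootSum (self_mem_pieceRoots hβ) hx))
    rw [h0] at this
    exact hx0 this
  -- If J contains one root space of 𝔭_i, irreducibility and passage to negative roots give all of
  -- 𝔭_i, hence 𝔤_i. Otherwise J lies in 𝔨.
  by_cases hex : ∃ γ ∈ signedPieceRoots θ P β, rootSpace 𝔥 γ ≤ J.toSubmodule
  · exfalso
    obtain ⟨γ, hγ, hγJ⟩ : ∃ γ ∈ pieceRoots θ P β, rootSpace 𝔥 γ ≤ J.toSubmodule := by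
      obtain ⟨γ, hγ | hγ, hγJ⟩ := hex
      · exact ⟨γ, hγ, hγJ⟩
      · refine ⟨-γ, hγ, rootSpace_neg_le_of_le ?_ hγJ⟩
        exact (h.signedPieceRoots_roots (Or.inr hγ)).1
    obtain ⟨x, hx, hx0⟩ := exists_ne_zero_of_mem_roots (h.positive.subset_roots hγ.1.1)
    have h1 : piece θ P β ≤ J.toSubmodule :=
      (h.isIrreducibleSubspace_piece hβ).le_of_mem (fun a _ b hb => J.lie_mem hb)
        (rootSpace_le_rootSum hγ hx) (hγJ hx) hx0
    have h2 : withNegative 𝔥 (piece θ P β) ≤ J.toSubmodule := by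
      rw [h.withNegative_piece, signedPieceRoots, rootSum_union]
      refine sup_le h1 (rootSum_le fun δ hδ => ?_)
      have hδ' : -δ ∈ pieceRoots θ P β := hδ
      have := rootSpace_neg_le_of_le (J := J) (h.positive.subset_roots hδ'.1.1)
        ((rootSpace_le_rootSum hδ').trans h1)
      rwa [neg_neg] at this
    have h3 : (h.pieceIdeal hg hβ).toSubmodule ≤ J.toSubmodule :=
      sup_le (fun z hz => mem_of_mem_bracket
        (fun a ha b hb => lie_mem_left ℂ 𝔤 J a b (h2 ha)) hz) h2
    exact not_le_of_gt hJ h3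
  · have hJk : J.toSubmodule ≤ (kk θ).toSubmodule := by
      rw [eq_iSup_inf_rootSpace (𝔥 := 𝔥) J.toSubmodule fun H _ x hx => J.lie_mem hx]
      refine iSup_le fun γ => ?_
      by_cases hγ0 : γ = 0
      · subst hγ0
        exact inf_le_right.trans (rootSpace_zero.le.trans h.cartan_le)
      by_cases hb : J.toSubmodule ⊓ rootSpace 𝔥 γ = ⊥
      · rw [hb]; exact bot_le
      have hγ : γ ∈ roots 𝔥 := ⟨hγ0, fun h0 => hb (by rw [h0, inf_bot_eq])⟩
      have hγJ := (inf_eq_bot_or_rootSpace_le hγ _).resolve_left hb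
      refine inf_le_right.trans ?_
      refine (rootSpace_le_kk_or_pp h.involutive h.cartan_le hγ).resolve_right fun hpp => hex ?_
      refine ⟨γ, mem_of_rootSpace_le_rootSum hγ ?_, hγJ⟩
      rw [← h.withNegative_piece, ← h.pieceIdeal_inf_pp hg hβ]
      exact le_inf (hγJ.trans hJ.le) hpp
    rw [LieSubmodule.eq_bot_iff]
    -- Here [J, 𝔭_i] lies both in J ⊆ 𝔨 and in 𝔭, so it vanishes.
    refine fun x hx => h.eq_zero_of_lie_withNegative hg fun β' hβ' y hy => ?_
    by_cases hne : β = β'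
    · subst hne
      exact eq_zero_of_mem_kk_of_mem_pp (hJk (lie_mem_left ℂ 𝔤 J x y hx))
        (lie_mem_pp_of_kk (hJk hx) (h.withNegative_le_pp β hy))
    · exact h.lie_pieceIdeal_eq_zero hg hβ hβ' hne (hJ.le hx)
        (h.withNegative_le_pieceIdeal hg hβ' hy)

variable {ι : Type*} {b : ι → Module.Dual ℂ 𝔥} (hbm : ∀ i, b i ∈ noncompactSimpleRoots θ P)

lemma iSup_pieceIdeal (hb_range : Set.range b = noncompactSimpleRoots θ P) :
    ⨆ i, h.pieceIdeal hg (hbm i) = ⊤ := by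
  have hp : pTotal θ P ≤ (⨆ i, h.pieceIdeal hg (hbm i)).toSubmodule := h.pTotal_le fun β hβ => by
    obtain ⟨i, rfl⟩ : ∃ i, b i = β := by rwa [← hb_range] at hβ
    exact (h.withNegative_le_pieceIdeal hg (hbm i)).trans
      (le_iSup (fun i => h.pieceIdeal hg (hbm i)) i)
  have hgt : gTotal θ P ≤ (⨆ i, h.pieceIdeal hg (hbm i)).toSubmodule :=
    sup_le (fun z hz => mem_of_mem_bracket
      (fun a ha b hb => lie_mem_left ℂ 𝔤 _ a b (hp ha)) hz) hp
  rw [hg] at hgt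
  exact top_le_iff.mp hgt

/-- An element of one ideal and of the sum of the others commutes with every 𝔭_j: with its own
through the second membership, with the rest through the first. -/
lemma iSupIndep_pieceIdeal (hb : Function.Injective b)
    (hb_range : Set.range b = noncompactSimpleRoots θ P) :
    iSupIndep fun i => h.pieceIdeal hg (hbm i) := by
  intro i
  rw [disjoint_iff, LieSubmodule.eq_bot_iff]
  rintro x ⟨hxi, hx⟩
  refine h.eq_zero_of_lie_withNegative hg fun β hβ y hy => ?_
  obtain ⟨j, rfl⟩ : ∃ i, b i = β := by rwa [← hb_range] at hβ
  have hyj := h.withNegative_le_pieceIdeal hg (hbm j) hy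
  by_cases hij : i = j
  · subst hij
    have hle : (⨆ j, ⨆ (_ : j ≠ i), h.pieceIdeal hg (hbm j)).toSubmodule ≤
        LinearMap.ker (LieAlgebra.ad ℂ 𝔤 y) := by
      simp only [LieSubmodule.iSup_toSubmodule]
      exact iSup₂_le fun j hj z hz => h.lie_pieceIdeal_eq_zero hg (hbm i) (hbm j)
        (fun e => hj (hb e).symm) hyj hz
    have : ⁅y, x⁆ = 0 := hle hx
    rw [← lie_skew, this, neg_zero]
  · exact h.lie_pieceIdeal_eq_zero hg (hbm i) (hbm j) (fun e => hij (hb e)) hxi hyj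

end IsTotallyPositive

end HarishChandra

/-! ### Structure inherited by 𝔤_i and the criterion for simplicity -/

namespace HarishChandra

variable {𝔤 : Type*} [LieRing 𝔤] [LieAlgebra ℂ 𝔤] {θ : 𝔤 ≃ₗ⁅ℂ⁆ 𝔤} {𝔥 : LieSubalgebra ℂ 𝔤}
  {P : Set (Module.Dual ℂ 𝔥)} [FiniteDimensional ℂ 𝔤] [LieAlgebra.IsKilling ℂ 𝔤]
  [𝔥.IsCartanSubalgebra]

/-- If the root `γ = δ + ε` is a root of an ideal, then so is the root `δ`. -/
lemma rootSpace_le_of_eq_add {I : LieIdeal ℂ 𝔤} {γ δ ε : Module.Dual ℂ 𝔥} (hγ : γ ∈ roots 𝔥)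
    (hδ : δ ∈ roots 𝔥) (hε : ε ∈ roots 𝔥) (e : γ = δ + ε) (hI : rootSpace 𝔥 γ ≤ I.toSubmodule) :
    rootSpace 𝔥 δ ≤ I.toSubmodule := by
  have e' : γ + -ε = δ := by rw [e, add_neg_cancel_right]
  rw [← e'] at hδ ⊢
  exact rootSpace_add_le hγ (neg_mem_roots hε) hδ fun x hx y _ => lie_mem_left ℂ 𝔤 I x y (hI hx)

namespace IsTotallyPositive

variable (h : IsTotallyPositive θ P) (hg : gTotal θ P = ⊤) {β : Module.Dual ℂ 𝔥}
  (hβ : β ∈ noncompactSimpleRoots θ P)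

/-- The only non-compact simple root of `𝔤_i` is the restriction of `β_i`. -/
lemma noncompactSimpleRoots_pieceIdeal {C : LieIdeal ℂ 𝔤}
    (hIC : IsCompl (h.pieceIdeal hg hβ) C) :
    noncompactSimpleRoots (restrictInvolution θ h.involutive (h.pieceIdeal hg hβ)
        fun _ hx => h.map_mem_pieceIdeal hg hβ hx) (idealPositive P (h.pieceIdeal hg hβ)) =
      {restrictToIdeal (h.pieceIdeal hg hβ) β} := by
  set I := h.pieceIdeal hg hβ with hI
  have hθI : ∀ x ∈ I, θ x ∈ I := fun _ hx => h.map_mem_pieceIdeal hg hβ hx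
  have hβr := h.mem_roots_of_simple hβ
  have hβI : rootSpace 𝔥 β ≤ I.toSubmodule := (rootSpace_le_rootSum (self_mem_pieceRoots hβ)).trans
    (le_sup_left.trans (h.withNegative_le_pieceIdeal hg hβ))
  have hP := fun δ => mem_idealPositive_iff (δ := δ) h.positive hIC
  have hn := fun δ =>
    mem_noncompactRoots_extendDual (δ := δ) h.involutive hθI h.positive hIC
  have hext := extendDual_restrictToIdeal hIC hβr hβI
  refine Set.Subset.antisymm (fun δ hδ => ?_) (Set.singleton_subset_iff.mpr ⟨⟨?_, ?_⟩, ?_⟩)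
  · have h1 := (hn δ).mp hδ.2
    have h1r := h.positive.subset_roots h1.1
    have hδ0 : δ ≠ 0 := ((mem_roots_extendDual hIC).mpr h1r).1
    have hδI := rootSpace_extendDual_le hIC hδ0
    have hs : extendDual 𝔥 hIC δ ∈ signedPieceRoots θ P β := by
      refine mem_of_rootSpace_le_rootSum h1r ?_
      rw [← h.withNegative_piece, ← h.pieceIdeal_inf_pp hg hβ]
      exact le_inf hδI h1.2
    have hs' : extendDual 𝔥 hIC δ ∈ pieceRoots θ P β :=
      hs.resolve_right fun hs => h.positive.neg_notMem _ h1.1 hs.1.1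
    -- In a decomposition of a root of the ideal both summands are again roots of the ideal, so
    -- simplicity there implies simplicity in P.
    have hsimple : extendDual 𝔥 hIC δ ∈ noncompactSimpleRoots θ P := by
      refine ⟨⟨h1.1, fun a ha b hb e => ?_⟩, h1⟩
      have har := h.positive.subset_roots ha
      have hbr := h.positive.subset_roots hb
      have haI := rootSpace_le_of_eq_add h1r har hbr e hδI
      have hbI := rootSpace_le_of_eq_add h1r hbr har (e.trans (add_comm _ _)) hδI
      refine hδ.1.2 _ ⟨a, ⟨ha, haI⟩, rfl⟩ _ ⟨b, ⟨hb, hbI⟩, rfl⟩ (extendDual_injective hIC ?_)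
      rw [map_add, extendDual_restrictToIdeal hIC har haI,
        extendDual_restrictToIdeal hIC hbr hbI, e]
    have e := h.eq_of_mem_pieceRoots hβ hsimple hs' (self_mem_pieceRoots hsimple)
    exact (restrictToIdeal_extendDual hIC δ).symm.trans (congrArg (restrictToIdeal I) e.symm)
  · rw [hP, hext]
    exact hβ.1.1
  · intro a ha b hb e
    refine hβ.1.2 _ ((hP a).mp ha) _ ((hP b).mp hb) ?_
    rw [← hext, e, map_add]
  · rw [hn, hext]
    exact hβ.2

/-- The structure inherited by the ideals `𝔤_i`. -/
lemma exists_involution_pieceIdeal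
    [ComplementedLattice (LieSubmodule ℂ (kk θ) 𝔤)]
    (hsimple : LieAlgebra.IsSimple ℂ (h.pieceIdeal hg hβ)) :
    ∃ θ' : h.pieceIdeal hg hβ ≃ₗ⁅ℂ⁆ h.pieceIdeal hg hβ,
      (∀ x : h.pieceIdeal hg hβ, ((θ' x : h.pieceIdeal hg hβ) : 𝔤) = θ (x : 𝔤)) ∧
      IsHCPair θ' ∧
      (idealCartan 𝔥 (h.pieceIdeal hg hβ)).IsCartanSubalgebra ∧
      idealCartan 𝔥 (h.pieceIdeal hg hβ) ≤ kk θ' ∧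
      IsPositiveSystem (idealCartan 𝔥 (h.pieceIdeal hg hβ))
        (idealPositive P (h.pieceIdeal hg hβ)) ∧
      noncompactRoots θ' (idealPositive P (h.pieceIdeal hg hβ)) =
        totallyPositiveRoots θ' (idealPositive P (h.pieceIdeal hg hβ)) ∧
      Module.finrank ℂ (LieAlgebra.center ℂ (kk θ')) = 1 := by
  obtain ⟨C, hIC⟩ := exists_isCompl (h.pieceIdeal hg hβ)
  have hθI : ∀ x ∈ h.pieceIdeal hg hβ, θ x ∈ h.pieceIdeal hg hβ :=
    fun _ hx => h.map_mem_pieceIdeal hg hβ hx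
  have hr := h.restrict hθI hIC
  have hc := isCartanSubalgebra_idealCartan (𝔥 := 𝔥) hIC
  refine ⟨restrictInvolution θ h.involutive _ hθI, fun x => rfl,
    ⟨inferInstance, hr.involutive, complementedLattice_restrictInvolution h.involutive hθI hIC⟩,
    hc, hr.cartan_le, hr.positive, hr.total, ?_⟩
  -- The dimension formula for the centre is applied inside the ideal, which has a single
  -- non-compact simple root.
  rw [hr.finrank_center, h.noncompactSimpleRoots_pieceIdeal hg hβ hIC, Set.ncard_singleton]

include h hg in
/-- `𝔤` is simple if and only if `𝔭⁺` is irreducible, when `𝔤 = 𝔤_t`. -/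
lemma isSimple_iff [ComplementedLattice (LieSubmodule ℂ (kk θ) 𝔤)] :
    LieAlgebra.IsSimple ℂ 𝔤 ↔ IsIrreducibleSubspace θ (pPlus θ P) := by
  have hsup := h.iSup_pieceIdeal hg (b := ((↑) : noncompactSimpleRoots θ P → _))
    (fun i => i.2) Subtype.range_coe
  have hind := h.iSupIndep_pieceIdeal hg (b := ((↑) : noncompactSimpleRoots θ P → _))
    (fun i => i.2) Subtype.coe_injective Subtype.range_coe
  refine ⟨fun hs => ?_, fun hirr => ?_⟩
  · obtain ⟨β, hβ⟩ : (noncompactSimpleRoots θ P).Nonempty := by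
      by_contra hne
      have : IsEmpty (noncompactSimpleRoots θ P) :=
        Set.isEmpty_coe_sort.mpr (Set.not_nonempty_iff_eq_empty.mp hne)
      rw [iSup_of_empty] at hsup
      exact bot_ne_top hsup
    have htop : h.pieceIdeal hg hβ = ⊤ :=
      (hs.eq_bot_or_eq_top _).resolve_left (h.isAtom_pieceIdeal hg hβ).1
    have heq : pPlus θ P = piece θ P β := by
      rw [h.pPlus_eq_iSup_piece]
      refine le_antisymm (iSup₂_le fun β' hβ' => ?_) (le_iSup₂_of_le β hβ le_rfl)
      by_cases hne : β = β'
      · rw [hne]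
      -- A second piece would give a nonzero ideal disjoint from one that is already all of 𝔤.
      · have hd := hind.pairwiseDisjoint (i := ⟨β, hβ⟩) (j := ⟨β', hβ'⟩)
          fun e => hne (congrArg Subtype.val e)
        rw [Function.onFun, htop, top_disjoint] at hd
        exact absurd hd (h.isAtom_pieceIdeal hg hβ').1
    rw [heq]
    exact h.isIrreducibleSubspace_piece hβ
  · obtain ⟨β, hβ, e⟩ := h.isIrreducibleSubspace_iff_piece.mp ⟨hirr, le_rfl⟩
    have huniq : ∀ β' : noncompactSimpleRoots θ P, β' = ⟨β, hβ⟩ := fun β' => Subtype.ext <| by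
      have hr : (β' : Module.Dual ℂ 𝔥) ∈ pieceRoots θ P β := by
        rw [← rootSpace_le_piece_iff (h.mem_roots_of_simple β'.2), ← e]
        exact rootSpace_le_rootSum β'.2.2
      exact h.eq_of_mem_pieceRoots β'.2 hβ (self_mem_pieceRoots β'.2) hr
    have htop : h.pieceIdeal hg hβ = ⊤ := top_le_iff.mp <| hsup ▸ iSup_le fun β' => by
      rw [huniq β']
    have hatom := h.isAtom_pieceIdeal hg hβ
    rw [htop] at hatom
    have hna : ¬ IsLieAbelian 𝔤 := by
      intro hab
      exact hatom.1 ((LieSubmodule.eq_bot_iff _).mpr fun x _ =>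
        eq_zero_of_forall_lie fun y => trivial_lie_zero 𝔤 𝔤 y x)
    exact ⟨fun J => (eq_or_lt_of_le (le_top (a := J))).elim Or.inr
      fun hlt => Or.inl (hatom.2 J hlt),
      hna⟩

end IsTotallyPositive

end HarishChandra

/-! ### The main theorem -/

open HarishChandra in
theorem theorem3 {𝔤 : Type*} [LieRing 𝔤] [LieAlgebra ℂ 𝔤] [FiniteDimensional ℂ 𝔤]
    (θ : 𝔤 ≃ₗ⁅ℂ⁆ 𝔤) (hθ : IsHCPair θ)
    (𝔥 : LieSubalgebra ℂ 𝔤) (h_cartan : 𝔥.IsCartanSubalgebra) (h_le : 𝔥 ≤ kk θ)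
    (P : Set (Module.Dual ℂ 𝔥)) (hP : IsPositiveSystem 𝔥 P)
    (h_total : noncompactRoots θ P = totallyPositiveRoots θ P)
    (r : ℕ) (α : Fin r → Module.Dual ℂ 𝔥) (hα : Function.Injective α)
    (hα_range : Set.range α = simpleRoots (compactRoots θ P)) :
    -- the pieces and their lowest roots exist
    (∃ (s : ℕ) (W : Fin s → Submodule ℂ 𝔤) (β : Fin s → Module.Dual ℂ 𝔥),
      IsDecomposition θ P W ∧ ∀ i, IsLowestRoot θ P (W i) (β i)) ∧
    ∀ (s : ℕ) (W : Fin s → Submodule ℂ 𝔤), IsDecomposition θ P W →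
    ∀ β : Fin s → Module.Dual ℂ 𝔥, (∀ i, IsLowestRoot θ P (W i) (β i)) →
      -- the lowest root of each piece is unique
      (∀ i γ, IsLowestRoot θ P (W i) γ → γ = β i) ∧
      -- the simple roots of `P`
      Function.Injective (Fin.append α β) ∧
      Set.range (Fin.append α β) = simpleRoots P ∧
      -- (a)
      r + s = Module.finrank ℂ 𝔥 ∧
      -- (b)
      s = Module.finrank ℂ (LieAlgebra.center ℂ (kk θ)) ∧
      centre θ ≤ 𝔥.toSubmodule ∧
      LinearIndependent ℂ (fun i => restrictToCentre θ (β i)) ∧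
      -- (c)
      (∀ γ ∈ noncompactRoots θ P,
        ∃! im : Fin s × (Fin r → ℕ), γ = β im.1 + ∑ j, im.2 j • α j) ∧
      (∀ x ∈ pPlus θ P, ∀ y ∈ pPlus θ P, ⁅x, y⁆ = 0) ∧
      -- (e), first part: the pieces are exactly the irreducible submodules of `𝔭⁺`
      Function.Injective W ∧
      Set.range W = {V | IsIrreducibleSubspace θ V ∧ V ≤ pPlus θ P} ∧
      -- (d) and the second part of (e), when `𝔤 = 𝔤_t`
      (gTotal θ P = ⊤ →
        (∃ I : Fin s → LieIdeal ℂ 𝔤,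
          iSupIndep I ∧ ⨆ i, I i = ⊤ ∧
          ∀ i,
            -- `𝔤_i = 𝔨_i ⊕ 𝔭_i`
            (I i).toSubmodule ⊓ (kk θ).toSubmodule
              = bracket (withNegative 𝔥 (W i)) (withNegative 𝔥 (W i)) ∧
            (I i).toSubmodule ⊓ pp θ = withNegative 𝔥 (W i) ∧
            (I i).toSubmodule
              = bracket (withNegative 𝔥 (W i)) (withNegative 𝔥 (W i)) ⊔ withNegative 𝔥 (W i) ∧
            LieAlgebra.IsSimple ℂ (I i) ∧
            -- `𝔤_i` is stable under `θ`, and inherits the whole structure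
            ∃ θ' : I i ≃ₗ⁅ℂ⁆ I i, (∀ x : I i, ((θ' x : I i) : 𝔤) = θ (x : 𝔤)) ∧
              IsHCPair θ' ∧
              (idealCartan 𝔥 (I i)).IsCartanSubalgebra ∧
              idealCartan 𝔥 (I i) ≤ kk θ' ∧
              IsPositiveSystem (idealCartan 𝔥 (I i)) (idealPositive P (I i)) ∧
              noncompactRoots θ' (idealPositive P (I i))
                = totallyPositiveRoots θ' (idealPositive P (I i)) ∧
              Module.finrank ℂ (LieAlgebra.center ℂ (kk θ')) = 1) ∧
        (LieAlgebra.IsSimple ℂ 𝔤 ↔ IsIrreducibleSubspace θ (pPlus θ P))) := by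
  -- Semisimplicity supplies the nondegenerate Killing form used throughout.
  have := hθ.semisimple
  have := hθ.reductive
  have h : IsTotallyPositive θ P := ⟨hθ.involutive, h_le, hP, h_total⟩
  refine ⟨h.exists_isDecomposition, fun s W hW β hβ => ?_⟩
  obtain ⟨b, hb, hb_range, hWb⟩ := h.exists_piece_eq_of_isDecomposition hW
  have hbm : ∀ i, b i ∈ noncompactSimpleRoots θ P := fun i => hb_range ▸ Set.mem_range_self i
  -- Both the decomposition and the lowest roots are forced, so W and β may be replaced by the
  -- pieces and the non-compact simple roots.
  obtain rfl : W = fun i => piece θ P (b i) := funext hWb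
  obtain rfl : β = b := funext fun i => (h.isLowestRoot_piece_iff (hbm i)).mp (hβ i)
  have hs : s = (noncompactSimpleRoots θ P).ncard := by
    rw [← hb_range, ← Set.image_univ, Set.ncard_image_of_injective _ hb, Set.ncard_univ,
      Nat.card_fin]
  have hr : r = (simpleRoots (compactRoots θ P)).ncard := by
    rw [← hα_range, ← Set.image_univ, Set.ncard_image_of_injective _ hα, Set.ncard_univ,
      Nat.card_fin]
  refine ⟨fun i γ hγ => (h.isLowestRoot_piece_iff (hbm i)).mp hγ,
    Fin.append_injective_iff.mpr ⟨hα, hb, fun i j e => ?_⟩, ?_, ?_, ?_, h.centre_le_cartan,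
    h.linearIndependent_restrictToCentre hb hbm,
    fun γ hγ => h.existsUnique_eq_add_sum hα hα_range hb hb_range hγ,
    fun x hx y hy => h.lie_eq_zero_of_pPlus hx hy, fun i j e => ?_, ?_, fun hg => ⟨?_, ?_⟩⟩
  · exact Set.disjoint_left.mp h.disjoint_simpleRoots (hα_range ▸ Set.mem_range_self i)
      (e ▸ hbm j)
  · rw [h.simpleRoots_eq, ← hα_range, ← hb_range]
    ext γ
    constructor
    · rintro ⟨i, rfl⟩
      refine Fin.addCases (fun i => ?_) (fun i => ?_) i
      · exact Or.inl ⟨i, (Fin.append_left α β i).symm⟩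
      · exact Or.inr ⟨i, (Fin.append_right α β i).symm⟩
    · rintro (⟨i, rfl⟩ | ⟨i, rfl⟩)
      · exact ⟨_, Fin.append_left α β i⟩
      · exact ⟨_, Fin.append_right α β i⟩
  · rw [hr, hs, h.ncard_add_ncard]
  · rw [hs, h.finrank_center]
  · have e' : piece θ P (β i) = piece θ P (β j) := e
    exact hb ((h.isLowestRoot_piece_iff (hbm j)).mp (e' ▸ hβ i))
  · ext V
    rw [Set.mem_ofPred_eq, h.isIrreducibleSubspace_iff_piece, ← hb_range, Set.exists_range_iff]
    exact exists_congr fun i => eq_comm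
  · have hsimple := fun i =>
      LieAlgebra.IsSemisimple.isSimple_of_isAtom _ (h.isAtom_pieceIdeal hg (hbm i))
    exact ⟨fun i => h.pieceIdeal hg (hbm i), h.iSupIndep_pieceIdeal hg hbm hb hb_range,
      h.iSup_pieceIdeal hg hbm hb_range, fun i => ⟨h.pieceIdeal_inf_kk hg (hbm i),
        h.pieceIdeal_inf_pp hg (hbm i), h.pieceIdeal_toSubmodule hg (hbm i), hsimple i,
        h.exists_involution_pieceIdeal hg (hbm i) (hsimple i)⟩⟩
  · exact h.isSimple_iff hg
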